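/- Terminology. A graph of groups $\mathcal G$ consists of a non-empty connected oriented graph (possibly infinite, loops and multiple edges allowed) with a group $G_v$ for each vertex $v$, a group $G_e$ for each edge $e$, and injective homomorphisms from $G_e$ to the vertex groups at the two endpoints of $e$. A group $G$ *splits as a graph of free groups* if it is isomorphic to the fundamental group of a graph of groups all of whose vertex groups are free, of arbitrary, possibly zero or infinite, rank; nothing further is assumed on the edge groups. Let $g$ be an infinite-order element of a group $G$. It is *unbalanced* if there are $h\in G$ and $m,n\in\mathbb Z\setminus\{0\}$ with $|m|\ne|n|$ and $hg^mh^{-1}=g^n$. It is *very unbalanced* if there are $h\in G$ and $m,n\in\mathbb Z\setminus\{0\}$ with $1,|m|,|n|$ pairwise distinct such that $hg^mh^{-1}=g^n$; if $n\mid m$ then $hg^{m/n}h^{-1}\neq g$; and if $m\mid n$ then $hgh^{-1}\neq g^{n/m}$. For non-zero integers $p,q$, $BS(p,q)=\langle a,t\mid ta^pt^{-1}=a^q\rangle$. A group embeds in $G$ if there is an injective homomorphism from it to $G$. A group is LERF if each of its finitely generated subgroups is an intersection of finite-index subgroups, and residually finite if the intersection of its finite-index normal subgroups is trivial. Proposition.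 Let $G$ be a group which splits as a graph of free groups. (1) $G$ contains an unbalanced element if and only if there exist $p,q\in\mathbb Z\setminus\{0\}$ with $|p|\neq|q|$ such that $BS(p,q)$ embeds in $G$. In that case, $G$ is not LERF. (2) $G$ contains a very unbalanced element if and only if there exist $p,q\in\mathbb Z\setminus\{0\}$ with $1,|p|,|q|$ pairwise distinct such that $BS(p,q)$ embeds in $G$. In that case, $G$ is not residually finite. -/

import Mathlib

/-- A graph of groups. The underlying graph is connected, with vertex set `V` and edge set `E`; loops
and multiple edges are allowed and `V`, `E` may be infinite. Each edge `e` carries one chosen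
orientation, from `src e` to `tgt e`, and the edge groups embed in the vertex groups at both ends. -/
structure GraphOfGroups (V : Type*) (E : Type*) where
  src : E → V
  tgt : E → V
  connected : ∀ v w : V, Relation.EqvGen (fun a b => ∃ e : E, src e = a ∧ tgt e = b) v w
  vertexGroup : V → Type*
  edgeGroup : E → Type*
  [vertexGroupInst : ∀ v, Group (vertexGroup v)]
  [edgeGroupInst : ∀ e, Group (edgeGroup e)]
  srcHom : ∀ e, edgeGroup e →* vertexGroup (src e)
  tgtHom : ∀ e, edgeGroup e →* vertexGroup (tgt e)
  srcHom_injective : ∀ e, Function.Injective (srcHom e)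
  tgtHom_injective : ∀ e, Function.Injective (tgtHom e)

namespace GraphOfGroups

attribute [instance] vertexGroupInst edgeGroupInst

/-- The free product of all the vertex groups and of the free group on the set of edges. -/
abbrev FreeProd {V E : Type*} (𝒢 : GraphOfGroups V E) : Type _ :=
  Monoid.Coprod (Monoid.CoprodI 𝒢.vertexGroup) (FreeGroup E)

/-- The elements `t_e * tgt_e(a) * t_e⁻¹ * src_e(a)⁻¹`, for `e` an edge and `a` in its edge group. -/
def relators {V E : Type*} (𝒢 : GraphOfGroups V E) : Set 𝒢.FreeProd :=
  {r | ∃ (e : E) (a : 𝒢.edgeGroup e),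
    r = Monoid.Coprod.inr (FreeGroup.of e) *
        Monoid.Coprod.inl (Monoid.CoprodI.of (𝒢.tgtHom e a)) *
        (Monoid.Coprod.inr (FreeGroup.of e))⁻¹ *
        (Monoid.Coprod.inl (Monoid.CoprodI.of (𝒢.srcHom e a)))⁻¹}

/-- The group generated by the vertex groups and by one letter `t_e` for each edge `e`,
subject to the relations `t_e * tgt_e(a) * t_e⁻¹ = src_e(a)` (Serre's group `F(𝒢)`). -/
abbrev PathGroup {V E : Type*} (𝒢 : GraphOfGroups V E) : Type _ :=
  𝒢.FreeProd ⧸ Subgroup.normalClosure 𝒢.relators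

/-- The image of a vertex group element in the path group. -/
def ofVertex {V E : Type*} (𝒢 : GraphOfGroups V E) (v : V) : 𝒢.vertexGroup v →* 𝒢.PathGroup :=
  (QuotientGroup.mk' (Subgroup.normalClosure 𝒢.relators)).comp
    (Monoid.Coprod.inl.comp Monoid.CoprodI.of)

/-- The letter `t_e` in the path group. -/
def ofEdge {V E : Type*} (𝒢 : GraphOfGroups V E) (e : E) : 𝒢.PathGroup :=
  QuotientGroup.mk' (Subgroup.normalClosure 𝒢.relators) (Monoid.Coprod.inr (FreeGroup.of e))

/-- `𝒢.PathFromTo v w x` means that `x` is represented by a path of the graph of groups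
from `v` to `w`, i.e. `x = g₀ * t_{e₁} ^ ε₁ * g₁ * ⋯ * t_{eₖ} ^ εₖ * gₖ` where
`e₁ ^ ε₁, …, eₖ ^ εₖ` is an edge path from `v` to `w` and each `gᵢ` lies in the group of the
`i`-th vertex of this path. -/
inductive PathFromTo {V E : Type*} (𝒢 : GraphOfGroups V E) : V → V → 𝒢.PathGroup → Prop
  | vertex (v : V) (g : 𝒢.vertexGroup v) : PathFromTo 𝒢 v v (𝒢.ofVertex v g)
  | edge (e : E) : PathFromTo 𝒢 (𝒢.src e) (𝒢.tgt e) (𝒢.ofEdge e)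
  | edgeInv (e : E) : PathFromTo 𝒢 (𝒢.tgt e) (𝒢.src e) (𝒢.ofEdge e)⁻¹
  | mul {u v w : V} {x y : 𝒢.PathGroup} :
      PathFromTo 𝒢 u v x → PathFromTo 𝒢 v w y → PathFromTo 𝒢 u w (x * y)

theorem PathFromTo.inv {V E : Type*} {𝒢 : GraphOfGroups V E} {v w : V} {x : 𝒢.PathGroup}
    (h : 𝒢.PathFromTo v w x) : 𝒢.PathFromTo w v x⁻¹ := by
  induction h with
  | vertex v g => rw [← map_inv]; exact .vertex v g⁻¹
  | edge e => exact .edgeInv e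
  | edgeInv e => rw [inv_inv]; exact .edge e
  | mul _ _ ih₁ ih₂ => rw [mul_inv_rev]; exact .mul ih₂ ih₁

/-- The fundamental group of a graph of groups, based at the vertex `v₀`: the group of
elements represented by closed paths at `v₀`. -/
def fundamentalGroup {V E : Type*} (𝒢 : GraphOfGroups V E) (v₀ : V) : Subgroup 𝒢.PathGroup where
  carrier := {x | 𝒢.PathFromTo v₀ v₀ x}
  mul_mem' hx hy := .mul hx hy
  one_mem' := by
    have h := PathFromTo.vertex (𝒢 := 𝒢) v₀ 1
    rwa [map_one] at h
  inv_mem' hx := hx.inv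

end GraphOfGroups

/-- The Baumslag-Solitar group `BS(p, q) = ⟨a, t ∣ t a ^ p t⁻¹ = a ^ q⟩`, where `a` is the
generator `0` and `t` is the generator `1`. -/
abbrev BaumslagSolitar (p q : ℤ) : Type :=
  PresentedGroup ({FreeGroup.of 1 * FreeGroup.of 0 ^ p * (FreeGroup.of 1)⁻¹ *
    (FreeGroup.of 0 ^ q)⁻¹} : Set (FreeGroup (Fin 2)))

/-- `A` embeds in `G`: there is an injective homomorphism from `A` to `G`. -/
def EmbedsIn (A G : Type*) [Group A] [Group G] : Prop :=
  ∃ f : A →* G, Function.Injective f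

/-- The infinite-order element `g` is unbalanced for `h`, `m`, `n`. -/
structure IsUnbalancedFor {G : Type*} [Group G] (g h : G) (m n : ℤ) : Prop where
  infinite_order : ¬ IsOfFinOrder g
  left_ne_zero : m ≠ 0
  right_ne_zero : n ≠ 0
  abs_ne : |m| ≠ |n|
  conj : h * g ^ m * h⁻¹ = g ^ n

/-- The infinite-order element `g` is very unbalanced for `h`, `m`, `n`. -/
structure IsVeryUnbalancedFor {G : Type*} [Group G] (g h : G) (m n : ℤ) : Prop where
  infinite_order : ¬ IsOfFinOrder g
  left_ne_zero : m ≠ 0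
  right_ne_zero : n ≠ 0
  left_abs_ne_one : |m| ≠ 1
  right_abs_ne_one : |n| ≠ 1
  abs_ne : |m| ≠ |n|
  conj : h * g ^ m * h⁻¹ = g ^ n
  conj_ne_of_right_dvd : n ∣ m → h * g ^ (m / n) * h⁻¹ ≠ g
  conj_ne_of_left_dvd : m ∣ n → h * g * h⁻¹ ≠ g ^ (n / m)

def IsUnbalanced {G : Type*} [Group G] (g : G) : Prop :=
  ∃ (h : G) (m n : ℤ), IsUnbalancedFor g h m n

def IsVeryUnbalanced {G : Type*} [Group G] (g : G) : Prop :=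
  ∃ (h : G) (m n : ℤ), IsVeryUnbalancedFor g h m n

/-- A group is LERF (locally extended residually finite, or subgroup separable) if each of its
finitely generated subgroups is an intersection of finite-index subgroups. -/
def IsLERF (G : Type*) [Group G] : Prop :=
  ∀ H : Subgroup G, H.FG → ∀ g : G, g ∉ H → ∃ K : Subgroup G, K.FiniteIndex ∧ H ≤ K ∧ g ∉ K

/-!
The path group `P` of the graph of groups is an HNN extension of the free product `B` of the vertex
groups, with one stable letter for each edge, so `P` acts without inversions on a tree with vertex
set `P ⧸ B`. The group `B` is free because the vertex groups are, and the fundamental group is a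
subgroup of `P`; hence `G` acts on a tree without inversions and with free vertex stabilizers. The
tree enters only through its distance function (`IsTreeDist`), which is read off from normal forms in
`P` (`GraphOfGroups.isTreeDist_treeDist`).

Let `h * g ^ m * h⁻¹ = g ^ n`. If `g` is unbalanced but not very unbalanced, then `h` or `h⁻¹`
conjugates `g` to a power `g ^ l` with `|l| ≠ 1`, and `BS(1, l)` embeds. Otherwise, translation lengths
show that `g` fixes a vertex, and then `h` translates an axis, because a free group has no unbalanced
elements. If `g` fixed a ray of this axis, all `h ^ (-j) * g * h ^ j` would lie in one cyclic subgroup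
of a vertex stabilizer, and comparing exponents would show that `g` is not very unbalanced. So `g`
leaves the axis of `h` at both ends, and for large `N` the element
`s = h ^ N * g * h ^ (-N - 1)` moves a suitable fixed point `x` of `g` out along the axis in the same
direction as `s⁻¹` does. Let `a` generate the centralizer of `g` in the stabilizer of `x`. Then `a`
moves the initial edges of the geodesics from `x` to `s • x` and `s⁻¹ • x`, and for
`k = s * a * s⁻¹ * a * s` there is a relation `k * a ^ p * k⁻¹ = a ^ q` such that `⟨a⟩` meets the
stabilizers of the initial parts of the geodesics from `x` to `k⁻¹ • x` and to `k • x` in `⟨a ^ p⟩` and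
`⟨a ^ q⟩` only. A ping-pong argument (`BaumslagSolitar.lift_injective_of_ping_pong`) shows that
`⟨a, k⟩` is `BS(p, q)`; see `IsTreeDist.exists_embedsIn_of_turns` and
`IsTreeDist.exists_embedsIn_of_isVeryUnbalanced`.

Conversely, the generator `a` of `BS(p, q)` is unbalanced, and very unbalanced if `1`, `|p|`, `|q|`
are distinct, by Britton's lemma. The failure of separability is seen in finite quotients, where
conjugate powers of `g` have equal order. Separating `⟨g ^ (m * n)⟩` from smaller powers of `g` yields
a finite quotient in which `m * n` divides the order of `g`, which forces `|m| = |n|`. In a finite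
quotient of `BS(p, q)` the conjugate elements `a ^ p` and `a ^ q` have equal order, so they generate the
same subgroup, which contains `a ^ d` for `d = gcd(p, q)`; hence `t * a ^ d * t⁻¹` and
`t⁻¹ * a ^ d * t` commute with `a` there. By Britton's lemma one of them does not commute with `a` in
`BS(p, q)`.
-/

/-! ### Powers and centralizers in free groups -/

/-- The word length of the powers of a nontrivial element of a free group grows linearly, the slope
being the length of the cyclic reduction. -/
theorem FreeGroup.exists_norm_pow_eq {α : Type*} [DecidableEq α] {z : FreeGroup α} (hz : z ≠ 1) :
    ∃ A r : ℕ, 0 < r ∧ ∀ n : ℕ, n ≠ 0 → (z ^ n).norm = A + n * r := by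
  refine ⟨2 * (FreeGroup.reduceCyclically.conjugator z.toWord).length,
    (FreeGroup.reduceCyclically z.toWord).length, ?_, fun n hn => ?_⟩
  · rw [List.length_pos_iff]
    intro h0
    apply hz
    have h1 := FreeGroup.reduceCyclically.conj_conjugator_reduceCyclically z.toWord
    rw [h0, List.append_nil] at h1
    rw [← FreeGroup.mk_toWord (x := z), ← h1, ← FreeGroup.mul_mk, ← FreeGroup.inv_mk,
      mul_inv_cancel]
  · rw [FreeGroup.norm, FreeGroup.toWord_pow,
      FreeGroup.reduceCyclically.reduce_flatten_replicate FreeGroup.isReduced_toWord]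
    simp [hn]
    ring

theorem FreeGroup.norm_zpow {α : Type*} [DecidableEq α] (z : FreeGroup α) (i : ℤ) :
    (z ^ i).norm = (z ^ i.natAbs).norm := by
  obtain h | h := Int.natAbs_eq i
  · conv_lhs => rw [h, zpow_natCast]
  · conv_lhs => rw [h, zpow_neg, zpow_natCast, FreeGroup.norm_inv_eq]

theorem FreeGroup.natAbs_le_of_conj_zpow {α : Type*} {u z : FreeGroup α} (hz : z ≠ 1)
    {i j : ℤ} (hi : i ≠ 0) (h : u * z ^ i * u⁻¹ = z ^ j) : j.natAbs ≤ i.natAbs := by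
  classical
  obtain ⟨A, r, hr, hpow⟩ := FreeGroup.exists_norm_pow_eq hz
  by_contra! hlt
  set k : ℕ := 2 * u.norm + 1 with hk
  have hconj : u * z ^ (i * k) * u⁻¹ = z ^ (j * k) := by
    rw [zpow_mul, zpow_mul, ← h, conj_zpow]
  have h1 : (z ^ (j * k)).norm ≤ u.norm + (z ^ (i * k)).norm + u.norm := by
    rw [← hconj]
    refine (FreeGroup.norm_mul_le _ _).trans ?_
    rw [FreeGroup.norm_inv_eq]
    exact Nat.add_le_add_right (FreeGroup.norm_mul_le _ _) _
  rw [FreeGroup.norm_zpow, FreeGroup.norm_zpow z (i * k), Int.natAbs_mul, Int.natAbs_mul,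
    Int.natAbs_natCast, hpow _ (Nat.mul_ne_zero (by omega) (by omega)),
    hpow _ (Nat.mul_ne_zero (by omega) (by omega))] at h1
  have h2 : (i.natAbs + 1) * k * r ≤ j.natAbs * k * r := by gcongr; omega
  have h3 : k ≤ k * r := Nat.le_mul_of_pos_right _ hr
  have h4 : (i.natAbs + 1) * k * r = i.natAbs * k * r + k * r := by ring
  omega

theorem IsFreeGroup.isMulTorsionFree (F : Type*) [Group F] [IsFreeGroup F] :
    IsMulTorsionFree F :=
  Function.Injective.isMulTorsionFree (IsFreeGroup.toFreeGroup F).toMonoidHom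
    (IsFreeGroup.toFreeGroup F).injective

/-- A free group has no unbalanced elements. -/
theorem IsFreeGroup.abs_eq_of_conj_zpow {F : Type*} [Group F] [IsFreeGroup F] {u z : F}
    (hz : z ≠ 1) {i j : ℤ} (hi : i ≠ 0) (hj : j ≠ 0) (h : u * z ^ i * u⁻¹ = z ^ j) :
    |i| = |j| := by
  set φ := IsFreeGroup.toFreeGroup F
  have hφ : φ z ≠ 1 := by simpa using hz
  have h' : φ u * φ z ^ i * (φ u)⁻¹ = φ z ^ j := by
    rw [← map_zpow, ← map_mul, ← map_inv, ← map_mul, h, map_zpow]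
  have h'' : (φ u)⁻¹ * φ z ^ j * (φ u)⁻¹⁻¹ = φ z ^ i := by rw [← h']; group
  have h1 := FreeGroup.natAbs_le_of_conj_zpow hφ hi h'
  have h2 := FreeGroup.natAbs_le_of_conj_zpow hφ hj h''
  rw [Int.abs_eq_natAbs, Int.abs_eq_natAbs, le_antisymm h2 h1]

theorem commute_of_commute_zpow {F : Type*} [Group F] [IsMulTorsionFree F] {y z : F} {k : ℤ}
    (hk : k ≠ 0) (h : Commute y (z ^ k)) : Commute y z := by
  have h1 : (y * z * y⁻¹) ^ k = z ^ k := by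
    rw [conj_zpow, h.eq, mul_inv_cancel_right]
  have h2 := zpow_left_injective hk h1
  exact mul_inv_eq_iff_eq_mul.mp h2

/-- Two distinct basis elements rule out a nontrivial central element: the generator `s` different
from the first letter of `z` makes `s * z` and `z * s` reduced words with different first letters. -/
theorem FreeGroup.subsingleton_of_mem_center {α : Type*} {z : FreeGroup α} (hz : z ≠ 1)
    (hc : ∀ y, Commute y z) : Subsingleton α := by
  classical
  by_contra hns
  rw [not_subsingleton_iff_nontrivial] at hns
  rcases hw : z.toWord with _ | ⟨c, w⟩
  · exact hz (FreeGroup.toWord_eq_nil_iff.mp hw)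
  obtain ⟨s, hs⟩ := exists_ne c.1
  have h1 : (FreeGroup.of s * z).toWord = (s, true) :: c :: w := by
    have hred : FreeGroup.IsReduced (c :: w) := hw ▸ FreeGroup.isReduced_toWord
    have hred' : FreeGroup.IsReduced ((s, true) :: c :: w) :=
      List.isChain_cons_cons.mpr ⟨fun h => absurd h hs, hred⟩
    rw [FreeGroup.toWord_mul, FreeGroup.toWord_of, hw, List.singleton_append, hred'.reduce_eq]
  have h2 : (z * FreeGroup.of s).toWord = (s, true) :: c :: w := by rw [← (hc _).eq, h1]
  have h3 : FreeGroup.reduce (c :: w ++ [(s, true)]) = (s, true) :: c :: w := by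
    rw [← h2, FreeGroup.toWord_mul, FreeGroup.toWord_of, hw]
  have h4 : FreeGroup.Red (c :: w ++ [(s, true)]) ((s, true) :: c :: w) :=
    h3 ▸ FreeGroup.reduce.red
  have h5 := h4.sublist.eq_of_length (by simp)
  simp only [List.cons_append, List.cons.injEq] at h5
  exact hs (congrArg Prod.fst h5.1)

/-- Centralizers of nontrivial elements of free groups are cyclic: such a centralizer is free with
nontrivial centre. -/
theorem IsFreeGroup.exists_commute_iff_mem_zpowers {F : Type*} [Group F] [IsFreeGroup F] {z : F}
    (hz : z ≠ 1) : ∃ a : F, ∀ y, Commute y z ↔ y ∈ Subgroup.zpowers a := by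
  set C : Subgroup F := Subgroup.centralizer {z}
  have hmem : ∀ y, y ∈ C ↔ Commute y z := fun y => by
    rw [Subgroup.mem_centralizer_singleton_iff]; rfl
  let zC : C := ⟨z, (hmem z).mpr (Commute.refl z)⟩
  set φ := IsFreeGroup.toFreeGroup C
  have hφ : φ zC ≠ 1 := by
    rw [ne_eq, map_eq_one_iff φ φ.injective]
    exact fun h => hz (congrArg Subtype.val h)
  have hsub : Subsingleton (IsFreeGroup.Generators C) := by
    refine FreeGroup.subsingleton_of_mem_center hφ fun y => ?_
    obtain ⟨y, rfl⟩ := φ.surjective y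
    refine Commute.map ?_ φ
    exact Subtype.ext ((hmem y).mp y.2)
  have hcyc : IsCyclic C := by
    rcases isEmpty_or_nonempty (IsFreeGroup.Generators C) with he | ⟨⟨s⟩⟩
    · have : Subsingleton C := φ.toEquiv.subsingleton
      infer_instance
    · have : Unique (IsFreeGroup.Generators C) := ⟨⟨s⟩, fun t => Subsingleton.elim _ _⟩
      refine ⟨φ.symm (FreeGroup.of s), fun y => ?_⟩
      have hy : φ y ∈ Subgroup.zpowers (FreeGroup.of s) := by
        have htop : Subgroup.closure (Set.range (FreeGroup.of (α := IsFreeGroup.Generators C))) = ⊤ :=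
          FreeGroup.closure_range_of _
        rw [Set.range_unique, ← Subgroup.zpowers_eq_closure] at htop
        rw [Subsingleton.elim s default, htop]
        exact Subgroup.mem_top _
      obtain ⟨n, hn⟩ := hy
      exact ⟨n, φ.injective (by simpa using hn)⟩
  obtain ⟨a, ha⟩ := hcyc
  refine ⟨a, fun y => ⟨fun hy => ?_, ?_⟩⟩
  · obtain ⟨n, hn⟩ := ha ⟨y, (hmem y).mpr hy⟩
    exact ⟨n, congrArg Subtype.val hn⟩
  · rintro ⟨n, rfl⟩
    exact ((hmem _).mp a.2).zpow_left n

/-! ### Trees as metric spaces -/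

/-- The axioms satisfied by the path metric on the vertices of a simplicial tree: a symmetric
distance with natural number values, triangles of even perimeter (the tree is bipartite), the
four-point condition, and vertices at every intermediate distance between two given ones. -/
structure IsTreeDist {X : Type*} (d : X → X → ℕ) : Prop where
  self : ∀ x, d x x = 0
  eq_of_zero : ∀ {x y}, d x y = 0 → x = y
  symm : ∀ x y, d x y = d y x
  even_perimeter : ∀ x y z, Even (d x y + d y z + d x z)
  four_point : ∀ x y z w, d x z + d y w ≤ max (d x y + d z w) (d x w + d y z)
  exists_point : ∀ {x y k}, k ≤ d x y → ∃ z, d x z = k ∧ d z y + k = d x y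

/-- The Gromov product of `x` and `y` at `o`: in a tree, the length of the common initial segment
of the geodesics from `o` to `x` and to `y`. The division is exact and the subtraction does not
truncate when `d` is a tree distance. -/
def gromovProd {X : Type*} (d : X → X → ℕ) (o x y : X) : ℕ := (d o x + d o y - d x y) / 2

namespace IsTreeDist

variable {X : Type*} {d : X → X → ℕ}

theorem triangle (hd : IsTreeDist d) (x y z : X) : d x z ≤ d x y + d y z := by
  have h1 := hd.four_point x y z y
  have h2 := hd.self y
  have h3 := hd.symm z y
  omega

theorem two_mul_gromovProd (hd : IsTreeDist d) (o x y : X) :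
    2 * gromovProd d o x y + d x y = d o x + d o y := by
  have h1 := hd.triangle x o y
  have h2 := hd.symm x o
  obtain ⟨k, hk⟩ := hd.even_perimeter o x y
  unfold gromovProd
  omega

theorem gromovProd_comm (hd : IsTreeDist d) (o x y : X) :
    gromovProd d o x y = gromovProd d o y x := by
  have h1 := hd.two_mul_gromovProd o x y
  have h2 := hd.two_mul_gromovProd o y x
  have h3 := hd.symm x y
  omega

theorem gromovProd_le_left (hd : IsTreeDist d) (o x y : X) : gromovProd d o x y ≤ d o x := by
  have h1 := hd.two_mul_gromovProd o x y
  have h2 := hd.triangle o x y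
  omega

theorem gromovProd_le_right (hd : IsTreeDist d) (o x y : X) : gromovProd d o x y ≤ d o y := by
  rw [hd.gromovProd_comm]
  exact hd.gromovProd_le_left o y x

theorem le_gromovProd_trans (hd : IsTreeDist d) {o x y z : X} {k : ℕ}
    (hxy : k ≤ gromovProd d o x y) (hyz : k ≤ gromovProd d o y z) : k ≤ gromovProd d o x z := by
  have h1 := hd.two_mul_gromovProd o x y
  have h2 := hd.two_mul_gromovProd o y z
  have h3 := hd.two_mul_gromovProd o x z
  have h4 := hd.four_point o x y z
  omega

theorem eq_of_le_gromovProd (hd : IsTreeDist d) {o x y : X} (hx : d o x ≤ gromovProd d o x y)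
    (hy : d o y ≤ gromovProd d o x y) : x = y := by
  have h1 := hd.two_mul_gromovProd o x y
  exact hd.eq_of_zero (by omega)

/-- A point `x` of the geodesic from `o` to `w` has Gromov product `d o x` with `w`. -/
theorem gromovProd_eq_of_between (hd : IsTreeDist d) {o x w : X} (h : d o x + d x w = d o w) :
    gromovProd d o x w = d o x := by
  have h1 := hd.two_mul_gromovProd o x w
  omega

theorem eq_of_between (hd : IsTreeDist d) {o x y w : X} (hx : d o x + d x w = d o w)
    (hy : d o y + d y w = d o w) (hxy : d o x = d o y) : x = y := by
  have h1 := hd.gromovProd_eq_of_between hx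
  have h2 := hd.gromovProd_eq_of_between hy
  rw [hd.gromovProd_comm] at h2
  have h3 : d o x ≤ gromovProd d o x y :=
    hd.le_gromovProd_trans (y := w) h1.ge (hxy.le.trans h2.ge)
  exact hd.eq_of_le_gromovProd h3 (by omega)

/-- Two geodesics that overlap in a nondegenerate segment concatenate to a geodesic. -/
theorem dist_concat (hd : IsTreeDist d) {a b c e : X} (h1 : d a b + d b c = d a c)
    (h2 : d b c + d c e = d b e) (hbc : d b c ≠ 0) : d a e = d a c + d c e := by
  have h3 := hd.four_point a b c e
  have h4 := hd.triangle a c e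
  omega

theorem gromovProd_add (hd : IsTreeDist d) (o x z : X) :
    gromovProd d o x z + gromovProd d x o z = d o x := by
  have h1 := hd.two_mul_gromovProd o x z
  have h2 := hd.two_mul_gromovProd x o z
  have h3 := hd.symm x o
  omega

section Action

variable {G : Type*} [Group G] [MulAction G X]

theorem gromovProd_smul (hG : ∀ (g : G) (x y : X), d (g • x) (g • y) = d x y) (g : G) (o x y : X) :
    gromovProd d (g • o) (g • x) (g • y) = gromovProd d o x y := by
  simp only [gromovProd, hG]

theorem gromovProd_smul_of_smul_eq (hG : ∀ (g : G) (x y : X), d (g • x) (g • y) = d x y) {g : G}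
    {o : X} (ho : g • o = o) (x y : X) :
    gromovProd d o (g • x) (g • y) = gromovProd d o x y := by
  rw [← gromovProd_smul hG g o x y, ho]

theorem smul_eq_of_between (hd : IsTreeDist d)
    (hG : ∀ (g : G) (x y : X), d (g • x) (g • y) = d x y) {g : G} {o z w : X}
    (ho : g • o = o) (hw : g • w = w) (hz : d o z + d z w = d o w) : g • z = z := by
  have h1 := hG g o z
  have h2 := hG g z w
  rw [ho] at h1
  rw [hw] at h2
  exact hd.eq_of_between (w := w) (by omega) hz h1

/-- If `g` fixes `o`, the geodesics from `o` to `w` and to `g • w` part at a point fixed by `g`. -/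
theorem exists_last_fixed (hd : IsTreeDist d)
    (hG : ∀ (g : G) (x y : X), d (g • x) (g • y) = d x y) {g : G} {o w : X} (ho : g • o = o) :
    ∃ x, g • x = x ∧ d o x + d x w = d o w ∧ gromovProd d x w (g • w) = 0 := by
  have hle := hd.gromovProd_le_left o w (g • w)
  obtain ⟨x, hx1, hx2⟩ := hd.exists_point hle
  have hxw : d o x + d x w = d o w := by omega
  have h1 := hd.gromovProd_eq_of_between hxw
  have h2 : gromovProd d o (g • x) (g • w) = d o x := by
    rw [← h1, ← gromovProd_smul hG g o x w, ho]
  have h3 : d o (g • x) = d o x := by rw [← hG g o x, ho]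
  have h4 : d o (g • w) = d o w := by rw [← hG g o w, ho]
  have hfix : g • x = x := by
    refine (hd.eq_of_between (o := o) (w := g • w) ?_ ?_ h3)
    · rw [h3, h4, hG, hxw]
    · have h5 := hd.two_mul_gromovProd o x (g • w)
      have h6 : d o x ≤ gromovProd d o x (g • w) :=
        hd.le_gromovProd_trans (y := w) h1.ge hx1.le
      have h7 := hd.gromovProd_le_left o x (g • w)
      omega
  refine ⟨x, hfix, hxw, ?_⟩
  have h5 := hd.two_mul_gromovProd x w (g • w)
  have h6 := hd.two_mul_gromovProd o w (g • w)
  have h7 : d x (g • w) = d x w := by rw [← hG g x w, hfix]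
  omega

theorem dist_pow_smul_of_geodesic (hd : IsTreeDist d)
    (hG : ∀ (g : G) (x y : X), d (g • x) (g • y) = d x y) {g : G} {v : X}
    (hne : d v (g • v) ≠ 0) (h2 : d v (g • g • v) = 2 * d v (g • v)) (j : ℕ) :
    d v (g ^ j • v) = j * d v (g • v) := by
  have hstep : ∀ i : ℕ, d (g ^ i • v) (g ^ (i + 1) • v) = d v (g • v) := fun i => by
    rw [pow_succ, mul_smul, hG]
  have hstep2 : ∀ i : ℕ, d (g ^ i • v) (g ^ (i + 2) • v) = 2 * d v (g • v) := fun i => by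
    rw [pow_add, mul_smul, hG, pow_two, mul_smul, h2]
  suffices ∀ j : ℕ, d v (g ^ j • v) = j * d v (g • v) ∧
      d v (g ^ (j + 1) • v) = (j + 1) * d v (g • v) from (this j).1
  intro j
  induction j with
  | zero => simp [hd.self]
  | succ j ih =>
    refine ⟨by simpa using ih.2, ?_⟩
    have h3 : d v (g ^ (j + 2) • v) =
        d v (g ^ (j + 1) • v) + d (g ^ (j + 1) • v) (g ^ (j + 2) • v) := by
      refine hd.dist_concat (b := g ^ j • v) ?_ ?_ ?_
      · rw [ih.1, ih.2, hstep]; ring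
      · rw [hstep, hstep (j + 1), hstep2]; ring
      · rwa [hstep]
    rw [show j + 1 + 1 = j + 2 from rfl, h3, ih.2, hstep (j + 1)]
    ring

/-- An automorphism of a tree that does not invert an edge either fixes the midpoint of the
geodesic from `o` to `g • o`, or translates an axis. -/
theorem fixed_point_or_axis (hd : IsTreeDist d)
    (hG : ∀ (g : G) (x y : X), d (g • x) (g • y) = d x y) (g : G)
    (hinv : ∀ z : X, g • g • z = z → Even (d z (g • z))) (o : X) :
    (∃ z, g • z = z ∧ d o z + d z (g • o) = d o (g • o)) ∨
      ∃ (v : X) (δ : ℕ), δ ≠ 0 ∧ ∀ j : ℕ, d v (g ^ j • v) = j * δ := by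
  have hd1 : d (g • o) (g • g • o) = d o (g • o) := hG _ _ _
  have hE := hd.even_perimeter o (g • o) (g • g • o)
  have hgp := hd.two_mul_gromovProd (g • o) o (g • g • o)
  have hs1 := hd.symm (g • o) o
  -- the image of the point `z` of `[o, g • o]` lies on `[g • o, g • g • o]`, which follows
  -- `[g • o, o]` up to the Gromov product at `g • o`
  have key : ∀ z : X, d o z + d z (g • o) = d o (g • o) →
      d o z ≤ gromovProd d (g • o) o (g • g • o) →
      d (g • o) (g • z) = d o z ∧ d (g • z) o + d o z = d o (g • o) := by
    intro z hz hle
    have h1 : d (g • o) (g • z) = d o z := hG _ _ _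
    have h2 : d (g • z) (g • g • o) = d z (g • o) := hG _ _ _
    refine ⟨h1, ?_⟩
    have h3 : gromovProd d (g • o) (g • z) (g • g • o) = d (g • o) (g • z) :=
      hd.gromovProd_eq_of_between (by omega)
    have h4 : d o z ≤ gromovProd d (g • o) (g • z) o :=
      hd.le_gromovProd_trans (y := g • g • o) (by omega)
        (by rw [hd.gromovProd_comm]; exact hle)
    have h5 := hd.two_mul_gromovProd (g • o) (g • z) o
    have h6 := hd.gromovProd_le_left (g • o) (g • z) o
    omega
  rcases Nat.lt_or_ge (d o (g • o)) (d o (g • g • o)) with hlt | hge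
  · right
    obtain ⟨e, he⟩ : ∃ e, 2 * e + d o (g • g • o) = 2 * d o (g • o) :=
      ⟨gromovProd d (g • o) o (g • g • o), by omega⟩
    have he' : gromovProd d (g • o) o (g • g • o) = e := by omega
    obtain ⟨v, hv1, hv2⟩ := hd.exists_point (x := o) (y := g • o) (k := e) (by omega)
    obtain ⟨h1, h2⟩ := key v (by omega) (by omega)
    have hδ : d v (g • v) + 2 * e = d o (g • o) := by
      have h3 : gromovProd d o v (g • o) = d o v := hd.gromovProd_eq_of_between (by omega)
      have h4 : gromovProd d o (g • v) (g • o) = d o (g • v) := by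
        refine hd.gromovProd_eq_of_between ?_
        have := hd.symm (g • v) o
        have := hd.symm (g • v) (g • o)
        omega
      have h5 := hd.symm (g • v) o
      have h6 : e ≤ gromovProd d o v (g • v) :=
        hd.le_gromovProd_trans (y := g • o) (by omega) (by rw [hd.gromovProd_comm]; omega)
      have h7 := hd.two_mul_gromovProd o v (g • v)
      have h8 := hd.gromovProd_le_left o v (g • v)
      omega
    refine ⟨v, d v (g • v), by omega, hd.dist_pow_smul_of_geodesic hG (by omega) ?_⟩
    -- the geodesic `[v, g • v]` followed by `[g • v, g • g • v]` does not backtrack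
    have h3 : d (g • v) (g • g • v) = d v (g • v) := hG _ _ _
    have h4 : gromovProd d (g • v) o (g • g • o) = 0 := by
      have h5 := hd.two_mul_gromovProd (g • v) o (g • g • o)
      have h6 : d (g • v) (g • g • o) = d v (g • o) := hG _ _ _
      omega
    have h5 : gromovProd d (g • v) v o = d v (g • v) := by
      have h6 := hd.two_mul_gromovProd (g • v) v o
      have := hd.symm (g • v) v
      have := hd.symm v o
      omega
    have h6 : gromovProd d (g • v) (g • g • v) (g • g • o) = d v (g • v) := by
      have h7 := hd.two_mul_gromovProd (g • v) (g • g • v) (g • g • o)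
      have h8 : d (g • v) (g • g • o) = d v (g • o) := hG _ _ _
      have h9 : d (g • g • v) (g • g • o) = d (g • v) (g • o) := hG _ _ _
      have := hd.symm (g • v) (g • o)
      omega
    by_contra hne
    have h7 := hd.two_mul_gromovProd (g • v) v (g • g • v)
    have h8 := hd.symm (g • v) v
    have h9 : 1 ≤ gromovProd d (g • v) o (g • g • o) := by
      refine hd.le_gromovProd_trans (y := v) ?_ (hd.le_gromovProd_trans (y := g • g • v) ?_ ?_)
      · rw [hd.gromovProd_comm]; omega
      · omega
      · omega
    omega
  · left
    obtain ⟨k, hk⟩ | ⟨k, hk⟩ := Nat.even_or_odd (d o (g • o))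
    · obtain ⟨z, hz1, hz2⟩ := hd.exists_point (x := o) (y := g • o) (k := k) (by omega)
      obtain ⟨h1, h2⟩ := key z (by omega) (by omega)
      refine ⟨z, hd.eq_of_between (o := o) (w := g • o) ?_ ?_ ?_, by omega⟩ <;>
      · have := hd.symm (g • z) o
        have := hd.symm (g • z) (g • o)
        omega
    · exfalso
      obtain ⟨z, hz1, hz2⟩ := hd.exists_point (x := o) (y := g • o) (k := k) (by omega)
      obtain ⟨z', hz1', hz2'⟩ := hd.exists_point (x := o) (y := g • o) (k := k + 1) (by omega)
      obtain ⟨h1, h2⟩ := key z (by omega) (by omega)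
      obtain ⟨h1', h2'⟩ := key z' (by omega) (by omega)
      have hz : g • z = z' := by
        refine hd.eq_of_between (o := o) (w := g • o) ?_ ?_ ?_ <;>
        · have := hd.symm (g • z) o
          have := hd.symm (g • z) (g • o)
          omega
      have hz' : g • z' = z := by
        refine hd.eq_of_between (o := o) (w := g • o) ?_ ?_ ?_ <;>
        · have := hd.symm (g • z') o
          have := hd.symm (g • z') (g • o)
          omega
      obtain ⟨l, hl⟩ := hinv z (by rw [hz, hz'])
      obtain ⟨l', hl'⟩ := hd.even_perimeter o z (g • z)
      rw [hz] at hl hl'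
      omega

/-- An element conjugate to its powers in an unbalanced way does not translate an axis, since the
distance moved by its powers grows linearly, at a rate that is invariant under conjugation. -/
theorem abs_eq_of_axis (hd : IsTreeDist d)
    (hG : ∀ (g : G) (x y : X), d (g • x) (g • y) = d x y) {g h : G} {m n : ℤ}
    (hconj : h * g ^ m * h⁻¹ = g ^ n) {v : X} {δ : ℕ} (hδ : δ ≠ 0)
    (hv : ∀ j : ℕ, d v (g ^ j • v) = j * δ) : |m| = |n| := by
  have hvz : ∀ i : ℤ, d v (g ^ i • v) = i.natAbs * δ := by
    intro i
    obtain hi | hi := Int.natAbs_eq i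
    · rw [← hv, ← zpow_natCast, ← hi]
    · rw [← hv, ← zpow_natCast, ← hG (g ^ (-i)) v, smul_smul, ← zpow_add, neg_add_cancel, zpow_zero,
        one_smul, hd.symm]
      congr 3
      omega
  set D := d v (h⁻¹ • v)
  have hbound : ∀ k : ℕ, n.natAbs * k * δ ≤ m.natAbs * k * δ + 2 * D ∧
      m.natAbs * k * δ ≤ n.natAbs * k * δ + 2 * D := by
    intro k
    have h1 : h * g ^ (m * k) * h⁻¹ = g ^ (n * k) := by
      rw [zpow_mul, zpow_mul, ← hconj, conj_zpow]
    have h2 : d v (g ^ (n * k) • v) = d (h⁻¹ • v) (g ^ (m * k) • h⁻¹ • v) := by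
      rw [← h1, ← hG h⁻¹ v, smul_smul, smul_smul]
      congr 2
      group
    have h3 := hvz (m * k)
    rw [hvz] at h2
    rw [Int.natAbs_mul, Int.natAbs_natCast] at h2 h3
    have h4 := hd.triangle (h⁻¹ • v) v (g ^ (m * k) • h⁻¹ • v)
    have h5 := hd.triangle v (g ^ (m * k) • v) (g ^ (m * k) • h⁻¹ • v)
    have h6 := hd.triangle v (h⁻¹ • v) (g ^ (m * k) • v)
    have h7 := hd.triangle (h⁻¹ • v) (g ^ (m * k) • h⁻¹ • v) (g ^ (m * k) • v)
    have h8 := hG (g ^ (m * k)) v (h⁻¹ • v)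
    have h9 := hd.symm v (h⁻¹ • v)
    have h10 := hd.symm (g ^ (m * k) • v) (g ^ (m * k) • h⁻¹ • v)
    omega
  obtain ⟨h1, h2⟩ := hbound (2 * D + 1)
  have hpos : 2 * D + 1 ≤ (2 * D + 1) * δ := Nat.le_mul_of_pos_right _ (by omega)
  rw [Int.abs_eq_natAbs, Int.abs_eq_natAbs]
  congr 1
  rcases lt_trichotomy m.natAbs n.natAbs with hlt | heq | hlt
  · have : (m.natAbs + 1) * ((2 * D + 1) * δ) ≤ n.natAbs * ((2 * D + 1) * δ) := by gcongr; omega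
    rw [add_mul, one_mul] at this
    rw [mul_assoc, mul_assoc] at h1 h2
    omega
  · exact heq
  · have : (n.natAbs + 1) * ((2 * D + 1) * δ) ≤ m.natAbs * ((2 * D + 1) * δ) := by gcongr; omega
    rw [add_mul, one_mul] at this
    rw [mul_assoc, mul_assoc] at h1 h2
    omega

/-- Seen from any point `o`, the ray along an axis eventually moves away at full speed. -/
theorem exists_ray_of_axis (hd : IsTreeDist d)
    (hG : ∀ (g : G) (x y : X), d (g • x) (g • y) = d x y) {h : G} {v : X} {δ : ℕ} (hδ : δ ≠ 0)
    (hv : ∀ j : ℕ, d v (h ^ j • v) = j * δ) (o : X) :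
    ∃ u : X, ∀ j : ℕ, d o (h ^ j • u) = d o u + j * δ ∧ d u (h ^ j • u) = j * δ := by
  have hst : ∀ i j : ℕ, d (h ^ i • v) (h ^ (i + j) • v) = j * δ := fun i j => by
    rw [pow_add, mul_smul, hG, hv]
  -- the four-point condition: once the distance to `o` fails to drop by `δ`, it rises by `δ`
  have hconv : ∀ i : ℕ, d o (h ^ (i + 1) • v) + δ ≤ d o (h ^ i • v) ∨
      d o (h ^ (i + 1) • v) + δ ≤ d o (h ^ (i + 2) • v) := by
    intro i
    have h1 := hd.four_point o (h ^ i • v) (h ^ (i + 1) • v) (h ^ (i + 2) • v)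
    have h2 := hst i 1
    have h3 : d (h ^ (i + 1) • v) (h ^ (i + 2) • v) = 1 * δ := hst (i + 1) 1
    have h4 := hst i 2
    omega
  obtain ⟨i, hi⟩ : ∃ i : ℕ, d o (h ^ (i + 1) • v) + δ ≤ d o (h ^ (i + 2) • v) := by
    by_contra! hcon
    have hdrop : ∀ i : ℕ, d o (h ^ i • v) + i * δ ≤ d o v := by
      intro i
      induction i with
      | zero => simp
      | succ i ih =>
        have h1 := (hconv i).resolve_right (not_le.mpr (hcon i))
        rw [add_mul]
        omega
    have h1 := hdrop (d o v + 1)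
    have h2 : d o v + 1 ≤ (d o v + 1) * δ := Nat.le_mul_of_pos_right _ (by omega)
    omega
  have hup : ∀ j : ℕ, d o (h ^ (i + 1 + j) • v) + δ ≤ d o (h ^ (i + 1 + j + 1) • v) := by
    intro j
    induction j with
    | zero => exact hi
    | succ j ih =>
      rcases hconv (i + 1 + j) with h1 | h1
      · exfalso; omega
      · exact h1
  refine ⟨h ^ (i + 1) • v, fun j => ?_⟩
  rw [smul_smul, ← pow_add, add_comm j]
  refine ⟨?_, hst _ _⟩
  induction j with
  | zero => simp
  | succ j ih =>
    have h1 := hup j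
    have h2 := hd.triangle o (h ^ (i + 1 + j) • v) (h ^ (i + 1 + j + 1) • v)
    have h3 := hst (i + 1 + j) 1
    rw [add_mul, ← add_assoc]
    omega

end Action

end IsTreeDist

/-! ### Baumslag-Solitar groups -/

namespace BaumslagSolitar

/-- The generator `a` of `BS(p, q) = ⟨a, t ∣ t a ^ p t⁻¹ = a ^ q⟩`. -/
def a (p q : ℤ) : BaumslagSolitar p q := PresentedGroup.of 0

/-- The stable letter `t` of `BS(p, q) = ⟨a, t ∣ t a ^ p t⁻¹ = a ^ q⟩`. -/
def t (p q : ℤ) : BaumslagSolitar p q := PresentedGroup.of 1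

theorem conj_a_zpow (p q : ℤ) : t p q * a p q ^ p * (t p q)⁻¹ = a p q ^ q := by
  have h := PresentedGroup.one_of_mem (rels := {FreeGroup.of (1 : Fin 2) * FreeGroup.of 0 ^ p *
    (FreeGroup.of 1)⁻¹ * (FreeGroup.of 0 ^ q)⁻¹}) rfl
  rw [map_mul, map_inv, mul_inv_eq_one] at h
  simp only [map_mul, map_inv, map_zpow] at h
  exact h

variable {p q : ℤ} {H : Type*} [Group H]

/-- The homomorphism from `BS(p, q)` given by a solution of its defining relation. -/
def lift (α τ : H) (h : τ * α ^ p * τ⁻¹ = α ^ q) : BaumslagSolitar p q →* H :=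
  PresentedGroup.toGroup (f := ![α, τ]) (by
    rintro r rfl
    simp [h])

@[simp]
theorem lift_a (α τ : H) (h : τ * α ^ p * τ⁻¹ = α ^ q) : lift α τ h (a p q) = α := by
  simp [lift, a]

@[simp]
theorem lift_t (α τ : H) (h : τ * α ^ p * τ⁻¹ = α ^ q) : lift α τ h (t p q) = τ := by
  simp [lift, t]

theorem hom_ext {f g : BaumslagSolitar p q →* H} (ha : f (a p q) = g (a p q))
    (ht : f (t p q) = g (t p q)) : f = g := by
  refine PresentedGroup.ext fun i => ?_
  fin_cases i
  · exact ha
  · exact ht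

theorem zpowGroupHom_injective (hp : p ≠ 0) :
    Function.Injective (zpowGroupHom p : Multiplicative ℤ →* Multiplicative ℤ) := by
  intro x y hxy
  have h : p * x.toAdd = p * y.toAdd := by
    simpa using congrArg Multiplicative.toAdd hxy
  exact Multiplicative.toAdd.injective (mul_left_cancel₀ hp h)

/-- The isomorphism between the subgroups `pℤ` and `qℤ` of `ℤ`, written multiplicatively. -/
noncomputable def rangeEquiv (hp : p ≠ 0) (hq : q ≠ 0) :
    (zpowGroupHom p : Multiplicative ℤ →* Multiplicative ℤ).range ≃*
      (zpowGroupHom q : Multiplicative ℤ →* Multiplicative ℤ).range :=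
  (MonoidHom.ofInjective (zpowGroupHom_injective hp)).symm.trans
    (MonoidHom.ofInjective (zpowGroupHom_injective hq))

theorem rangeEquiv_zpow (hp : p ≠ 0) (hq : q ≠ 0) (x : Multiplicative ℤ) :
    (rangeEquiv hp hq ⟨x ^ p, x, rfl⟩ : Multiplicative ℤ) = x ^ q := by
  have h : (⟨x ^ p, x, rfl⟩ : (zpowGroupHom p : Multiplicative ℤ →* Multiplicative ℤ).range) =
      MonoidHom.ofInjective (zpowGroupHom_injective hp) x := Subtype.ext rfl
  rw [rangeEquiv, MulEquiv.trans_apply, h, MulEquiv.symm_apply_apply]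
  rfl

/-- `BS(p, q)` as an HNN extension of the infinite cyclic group. -/
abbrev HNN (hp : p ≠ 0) (hq : q ≠ 0) : Type :=
  HNNExtension (Multiplicative ℤ) (zpowGroupHom p).range (zpowGroupHom q).range (rangeEquiv hp hq)

theorem hnn_conj (hp : p ≠ 0) (hq : q ≠ 0) :
    (HNNExtension.t : HNN hp hq) * HNNExtension.of (Multiplicative.ofAdd 1) ^ p *
      HNNExtension.t⁻¹ = HNNExtension.of (Multiplicative.ofAdd 1) ^ q := by
  rw [← map_zpow HNNExtension.of, ← map_zpow HNNExtension.of, ← rangeEquiv_zpow hp hq,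
    HNNExtension.equiv_eq_conj]

/-- The canonical homomorphism from `BS(p, q)` to the corresponding HNN extension. -/
noncomputable def toHNN (hp : p ≠ 0) (hq : q ≠ 0) : BaumslagSolitar p q →* HNN hp hq :=
  lift (HNNExtension.of (Multiplicative.ofAdd 1)) HNNExtension.t (hnn_conj hp hq)

/-- The homomorphism from the HNN extension presenting `BS(p, q)` given by a solution of the
defining relation. -/
noncomputable def hnnLift (hp : p ≠ 0) (hq : q ≠ 0) (α τ : H) (h : τ * α ^ p * τ⁻¹ = α ^ q) :
    HNN hp hq →* H :=
  HNNExtension.lift (zpowersHom H α) τ (by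
    rintro ⟨_, x, rfl⟩
    have h1 := rangeEquiv_zpow hp hq x
    have h2 : zpowersHom H α (zpowGroupHom p x) = (α ^ p) ^ x.toAdd := by
      rw [zpowGroupHom_apply, map_zpow, zpowersHom_apply, ← zpow_mul, ← zpow_mul, mul_comm]
    have h3 : zpowersHom H α (x ^ q) = (α ^ q) ^ x.toAdd := by
      rw [map_zpow, zpowersHom_apply, ← zpow_mul, ← zpow_mul, mul_comm]
    erw [h1]
    rw [h2, h3, ← h, conj_zpow]
    group)

theorem hnnLift_of (hp : p ≠ 0) (hq : q ≠ 0) (α τ : H) (h : τ * α ^ p * τ⁻¹ = α ^ q)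
    (x : Multiplicative ℤ) : hnnLift hp hq α τ h (HNNExtension.of x) = α ^ x.toAdd := by
  rw [hnnLift, HNNExtension.lift_of, zpowersHom_apply]

theorem hnnLift_t (hp : p ≠ 0) (hq : q ≠ 0) (α τ : H) (h : τ * α ^ p * τ⁻¹ = α ^ q) :
    hnnLift hp hq α τ h HNNExtension.t = τ := HNNExtension.lift_t ..

theorem hnnLift_toHNN (hp : p ≠ 0) (hq : q ≠ 0) (α τ : H) (h : τ * α ^ p * τ⁻¹ = α ^ q)
    (x : BaumslagSolitar p q) : hnnLift hp hq α τ h (toHNN hp hq x) = lift α τ h x := by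
  suffices (hnnLift hp hq α τ h).comp (toHNN hp hq) = lift α τ h from DFunLike.congr_fun this x
  apply hom_ext
  · simp [toHNN, hnnLift_of]
  · simp [toHNN, hnnLift_t]

theorem toHNN_injective (hp : p ≠ 0) (hq : q ≠ 0) : Function.Injective (toHNN hp hq) := by
  refine Function.LeftInverse.injective (g := hnnLift hp hq (a p q) (t p q) (conj_a_zpow p q))
    fun x => ?_
  rw [hnnLift_toHNN]
  have h : lift (a p q) (t p q) (conj_a_zpow p q) = MonoidHom.id _ := by apply hom_ext <;> simp
  rw [h, MonoidHom.id_apply]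

/-- The exponent `p` for `u = 1` and `q` for `u = -1`: the word `t ^ u * a ^ i * t ^ (-u)` can be
shortened in `BS(p, q)` exactly when `pinchExp p q u` divides `i`. -/
def pinchExp (p q : ℤ) (u : ℤˣ) : ℤ := if u = 1 then p else q

theorem ofAdd_mem_toSubgroup_iff (u : ℤˣ) (i : ℤ) :
    Multiplicative.ofAdd i ∈ HNNExtension.toSubgroup
      (zpowGroupHom p : Multiplicative ℤ →* Multiplicative ℤ).range (zpowGroupHom q).range u ↔
      pinchExp p q u ∣ i := by
  have key : ∀ r : ℤ, Multiplicative.ofAdd i ∈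
      (zpowGroupHom r : Multiplicative ℤ →* Multiplicative ℤ).range ↔ r ∣ i := by
    intro r
    constructor
    · rintro ⟨x, hx⟩
      exact ⟨x.toAdd, by simpa using (congrArg Multiplicative.toAdd hx).symm⟩
    · rintro ⟨c, rfl⟩
      refine ⟨Multiplicative.ofAdd c, ?_⟩
      rw [zpowGroupHom_apply, ← ofAdd_zsmul, smul_eq_mul]
  rcases Int.units_eq_one_or u with rfl | rfl
  · simpa [pinchExp] using key p
  · simpa [pinchExp] using key q

/-- Britton's lemma in `BS(p, q)`. -/
theorem eq_nil_of_prod_mem_zpowers (hp : p ≠ 0) (hq : q ≠ 0) (l : List (ℤˣ × ℤ))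
    (hl : l.IsChain fun x y => pinchExp p q x.1 ∣ x.2 → x.1 = y.1)
    (hmem : (l.map fun x => t p q ^ (x.1 : ℤ) * a p q ^ x.2).prod ∈ Subgroup.zpowers (a p q)) :
    l = [] := by
  let w : HNNExtension.NormalWord.ReducedWord (Multiplicative ℤ)
      (zpowGroupHom p : Multiplicative ℤ →* Multiplicative ℤ).range (zpowGroupHom q).range :=
    { head := 1
      toList := l.map fun x => (x.1, Multiplicative.ofAdd x.2)
      chain := by
        rw [List.isChain_map]
        exact hl.imp fun x y h hx => h ((ofAdd_mem_toSubgroup_iff _ _).mp hx) }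
  have hw : w.toList = [] := by
    apply HNNExtension.ReducedWord.toList_eq_nil_of_mem_of_range (rangeEquiv hp hq)
    obtain ⟨n, hn⟩ := hmem
    refine ⟨Multiplicative.ofAdd n, ?_⟩
    have h1 := congrArg (toHNN hp hq) hn
    have h2 : ∀ i : ℤ, (HNNExtension.of (Multiplicative.ofAdd i) : HNN hp hq) =
        HNNExtension.of (Multiplicative.ofAdd 1) ^ i := fun i => by
      rw [← map_zpow, ← ofAdd_zsmul, smul_eq_mul, mul_one]
    simp only [map_zpow, map_list_prod, List.map_map, toHNN, lift_a] at h1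
    rw [h2, h1, HNNExtension.NormalWord.ReducedWord.prod]
    simp only [w, map_one, one_mul, List.map_map]
    congr 2
    funext x
    simp only [Function.comp_apply, map_mul, map_zpow, lift_a, lift_t, h2 x.2]
  simpa [w] using hw

theorem a_zpow_eq_one (hp : p ≠ 0) (hq : q ≠ 0) {i : ℤ} (h : a p q ^ i = 1) : i = 0 := by
  have h1 : (HNNExtension.of (Multiplicative.ofAdd 1 ^ i) : HNN hp hq) = HNNExtension.of 1 := by
    simpa only [map_zpow, map_one, toHNN, lift_a] using congrArg (toHNN hp hq) h
  rw [← ofAdd_zsmul] at h1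
  simpa using congrArg Multiplicative.toAdd (HNNExtension.of_injective _ h1)

theorem conj_notMem_zpowers (hp : p ≠ 0) (hq : q ≠ 0) {i : ℤ} (hi : ¬ p ∣ i) :
    t p q * a p q ^ i * (t p q)⁻¹ ∉ Subgroup.zpowers (a p q) := by
  intro h
  have := eq_nil_of_prod_mem_zpowers hp hq [(1, i), (-1, 0)] (by simp [pinchExp, hi])
    (by simpa [mul_assoc] using h)
  simp at this

theorem not_commute_conj (hp : p ≠ 0) (hq : q ≠ 0) (hq1 : |q| ≠ 1) {i : ℤ} (hi : ¬ p ∣ i) :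
    ¬ Commute (t p q * a p q ^ i * (t p q)⁻¹) (a p q) := by
  intro h
  have hq1' : ¬ q ∣ 1 := fun h => hq1 (Int.isUnit_iff_abs_eq.mp (isUnit_of_dvd_one h))
  have h1 : t p q * a p q ^ i * (t p q)⁻¹ * a p q * (t p q * a p q ^ i * (t p q)⁻¹)⁻¹ = a p q :=
    mul_inv_eq_of_eq_mul h.eq
  have := eq_nil_of_prod_mem_zpowers hp hq [(1, i), (-1, 1), (1, -i), (-1, 0)]
    (by simp [pinchExp, hi, hq1']) (by
      convert Subgroup.mem_zpowers (a p q) using 1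
      refine Eq.trans ?_ h1
      simp [mul_assoc])
  simp at this

theorem not_commute_conj_inv (hp : p ≠ 0) (hq : q ≠ 0) (hp1 : |p| ≠ 1) {i : ℤ} (hi : ¬ q ∣ i) :
    ¬ Commute ((t p q)⁻¹ * a p q ^ i * t p q) (a p q) := by
  intro h
  have hp1' : ¬ p ∣ 1 := fun h => hp1 (Int.isUnit_iff_abs_eq.mp (isUnit_of_dvd_one h))
  have h1 : (t p q)⁻¹ * a p q ^ i * t p q * a p q * ((t p q)⁻¹ * a p q ^ i * t p q)⁻¹ = a p q :=
    mul_inv_eq_of_eq_mul h.eq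
  have := eq_nil_of_prod_mem_zpowers hp hq [(-1, i), (1, 1), (-1, -i), (1, 0)]
    (by simp [pinchExp, hi, hp1']) (by
      convert Subgroup.mem_zpowers (a p q) using 1
      refine Eq.trans ?_ h1
      simp [mul_assoc])
  simp at this

/-- A ping-pong criterion for embedding `BS(p, q)`. The set `Y u` plays the role of the points that
a reduced word beginning with `τ ^ u` sends the base point `x` to. -/
theorem lift_injective_of_ping_pong {X : Type*} [MulAction H X] (hp : p ≠ 0) (hq : q ≠ 0)
    {α τ : H} (h : τ * α ^ p * τ⁻¹ = α ^ q) (hα : ∀ i : ℤ, α ^ i = 1 → i = 0)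
    (Y : ℤˣ → Set X) (x : X) (hx : α • x = x) (hxY : ∀ u, x ∉ Y u)
    (hτ : ∀ (u : ℤˣ) (z : X), z ∉ Y (-u) → τ ^ (u : ℤ) • z ∈ Y u)
    (hne : ∀ (u : ℤˣ) (i : ℤ) (z : X), z ∈ Y u → α ^ i • z ∉ Y (-u))
    (hself : ∀ (u : ℤˣ) (i : ℤ) (z : X), z ∈ Y (-u) → α ^ i • z ∈ Y (-u) → pinchExp p q u ∣ i) :
    Function.Injective (lift α τ h) := by
  have hxi : ∀ i : ℤ, α ^ i • x = x := fun i =>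
    Subgroup.zpow_mem (MulAction.stabilizer H x) hx i
  have key : ∀ (l : List (ℤˣ × Multiplicative ℤ)) (u : ℤˣ) (g : Multiplicative ℤ),
      ((u, g) :: l).IsChain (fun x y => x.2 ∈ HNNExtension.toSubgroup
        (zpowGroupHom p : Multiplicative ℤ →* Multiplicative ℤ).range (zpowGroupHom q).range x.1 →
          x.1 = y.1) →
      (((u, g) :: l).map fun x => τ ^ (x.1 : ℤ) * α ^ x.2.toAdd).prod • x ∈ Y u := by
    intro l
    induction l with
    | nil =>
      intro u g _
      simp only [List.map_cons, List.map_nil, List.prod_cons, List.prod_nil, mul_one]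
      rw [mul_smul, hxi]
      exact hτ _ _ (hxY _)
    | cons y l ih =>
      obtain ⟨u', g'⟩ := y
      intro u g hl
      rw [List.isChain_cons_cons] at hl
      have hz := ih u' g' hl.2
      rw [List.map_cons, List.prod_cons, mul_smul, mul_smul]
      refine hτ _ _ fun hmem => ?_
      by_cases huu : u = u'
      · subst huu
        exact hne _ _ _ hz hmem
      · have hu' : u' = -u := Int.units_ne_iff_eq_neg.mp (Ne.symm huu)
        subst hu'
        exact huu (hl.1 ((ofAdd_mem_toSubgroup_iff u g.toAdd).mpr (hself _ _ _ hz hmem)))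
  rw [injective_iff_map_eq_one]
  intro y hy
  obtain ⟨d⟩ := HNNExtension.NormalWord.TransversalPair.nonempty (Multiplicative ℤ)
    (zpowGroupHom p : Multiplicative ℤ →* Multiplicative ℤ).range (zpowGroupHom q).range
  obtain ⟨w, hw⟩ : ∃ w : HNNExtension.NormalWord d, w.prod (rangeEquiv hp hq) = toHNN hp hq y :=
    ⟨(HNNExtension.NormalWord.equiv (rangeEquiv hp hq) d) (toHNN hp hq y),
      (HNNExtension.NormalWord.equiv (rangeEquiv hp hq) d).symm_apply_apply _⟩
  rw [← hnnLift_toHNN hp hq, ← hw, HNNExtension.NormalWord.ReducedWord.prod, map_mul, map_list_prod,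
    List.map_map, hnnLift_of] at hy
  have hmap : (hnnLift hp hq α τ h ∘ fun x : ℤˣ × Multiplicative ℤ =>
      HNNExtension.t ^ (x.1 : ℤ) * HNNExtension.of x.2) =
      fun x => τ ^ (x.1 : ℤ) * α ^ x.2.toAdd := by
    funext x
    simp [hnnLift_of, hnnLift_t]
  rw [hmap] at hy
  apply toHNN_injective hp hq
  rw [← hw, map_one, HNNExtension.NormalWord.ReducedWord.prod]
  rcases hl : w.toList with _ | ⟨⟨u, g⟩, l⟩
  · rw [hl, List.map_nil, List.prod_nil, mul_one] at hy
    rw [List.map_nil, List.prod_nil, mul_one, ← ofAdd_toAdd w.head, hα _ hy, ofAdd_zero, map_one]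
  · exfalso
    have hz := key l u g (hl ▸ w.chain)
    rw [← hl] at hz
    rw [mul_eq_one_iff_inv_eq] at hy
    rw [← hy, ← zpow_neg, hxi] at hz
    exact hxY _ hz

/-- If `τ * α * τ⁻¹ = α ^ n`, every element generated by `α` and `τ` has the form
`τ ^ (-i) * α ^ k * τ ^ j`. -/
theorem exists_eq_of_mem_closure {α τ : H} {n : ℤ} (h : τ * α * τ⁻¹ = α ^ n) {x : H}
    (hx : x ∈ Subgroup.closure {α, τ}) :
    ∃ (i j : ℕ) (k : ℤ), x = τ⁻¹ ^ i * α ^ k * τ ^ j := by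
  have hrel : ∀ k : ℤ, τ * α ^ k = α ^ (n * k) * τ := fun k => by
    rw [zpow_mul, ← h, conj_zpow]
    group
  have hpow : ∀ (i : ℕ) (k : ℤ), τ ^ i * α ^ k = α ^ (n ^ i * k) * τ ^ i := by
    intro i
    induction i with
    | zero => simp
    | succ i ih =>
      intro k
      rw [pow_succ, mul_assoc, hrel, ← mul_assoc, ih, mul_assoc, pow_succ, mul_assoc]
  have hmul : ∀ (k : ℤ) (x : H), (∃ (i j : ℕ) (k : ℤ), x = τ⁻¹ ^ i * α ^ k * τ ^ j) →
      ∃ (i j : ℕ) (k' : ℤ), α ^ k * x = τ⁻¹ ^ i * α ^ k' * τ ^ j := by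
    rintro k x ⟨i, j, k', rfl⟩
    refine ⟨i, j, n ^ i * k + k', ?_⟩
    rw [zpow_add, ← mul_inv_eq_iff_eq_mul.mpr (hpow i k)]
    simp only [inv_pow, ← mul_assoc, inv_mul_cancel, one_mul]
  induction hx using Subgroup.closure_induction_left with
  | one => exact ⟨0, 0, 0, by simp⟩
  | mul_left y hy z _ ih =>
    rcases hy with rfl | rfl
    · simpa only [zpow_one] using hmul 1 z ih
    · obtain ⟨i, j, k, rfl⟩ := ih
      cases i with
      | zero =>
        refine ⟨0, j + 1, n * k, ?_⟩
        rw [pow_zero, one_mul, one_mul, ← mul_assoc, hrel, pow_succ', mul_assoc]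
      | succ i =>
        refine ⟨i, j, k, ?_⟩
        rw [pow_succ']
        simp only [← mul_assoc, mul_inv_cancel, one_mul]
  | inv_mul_cancel y hy z _ ih =>
    rcases hy with rfl | rfl
    · simpa only [zpow_neg, zpow_one] using hmul (-1) z ih
    · obtain ⟨i, j, k, rfl⟩ := ih
      exact ⟨i + 1, j, k, by rw [pow_succ']; simp only [mul_assoc]⟩

theorem closure_a_t (p q : ℤ) : Subgroup.closure {a p q, t p q} = ⊤ := by
  rw [eq_top_iff, ← PresentedGroup.closure_range_of, Subgroup.closure_le]
  rintro _ ⟨i, rfl⟩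
  fin_cases i
  · exact Subgroup.subset_closure (Set.mem_insert _ _)
  · exact Subgroup.subset_closure (Set.mem_insert_of_mem _ rfl)

/-- An element of infinite order conjugate to a proper power of itself generates, together with the
conjugating element, a copy of `BS(1, n)`. -/
theorem embedsIn_of_conj_eq_zpow {b h : H} {n : ℤ} (hb : ¬ IsOfFinOrder b)
    (hn : |n| ≠ 1) (hconj : h * b * h⁻¹ = b ^ n) : EmbedsIn (BaumslagSolitar 1 n) H := by
  have hrel : h * b ^ (1 : ℤ) * h⁻¹ = b ^ n := by rwa [zpow_one]
  refine ⟨lift b h hrel, ?_⟩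
  have hinj : Function.Injective fun k : ℤ => b ^ k := injective_zpow_iff_not_isOfFinOrder.mpr hb
  have hpow : ∀ i : ℕ, h ^ i * b * (h ^ i)⁻¹ = b ^ (n ^ i) := by
    intro i
    induction i with
    | zero => simp
    | succ i ih =>
      have h1 : h ^ (i + 1) * b * (h ^ (i + 1))⁻¹ = h * (h ^ i * b * (h ^ i)⁻¹) * h⁻¹ := by
        rw [pow_succ']; group
      rw [h1, ih, ← conj_zpow, hconj, ← zpow_mul, pow_succ']
  have hcomm : ∀ i : ℕ, Commute (h ^ i) b → i = 0 := by
    intro i hi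
    have h1 := hpow i
    rw [hi.eq, mul_inv_cancel_right] at h1
    have h2 : n ^ i = 1 := hinj (by simpa using h1.symm)
    by_contra hne
    have h3 : |n| ^ i = 1 := by rw [← abs_pow, h2, abs_one]
    exact hn ((pow_eq_one_iff_of_nonneg (abs_nonneg n) hne).mp h3)
  rw [injective_iff_map_eq_one]
  intro x hx
  obtain ⟨i, j, k, rfl⟩ := exists_eq_of_mem_closure (α := a 1 n) (τ := t 1 n) (n := n) (x := x)
    (by simpa only [zpow_one] using conj_a_zpow 1 n) (closure_a_t 1 n ▸ Subgroup.mem_top x)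
  simp only [map_mul, map_pow, map_inv, map_zpow, lift_a, lift_t] at hx
  -- `b ^ k` is a power of `h`, so some power of `h` commutes with `b`
  have h1 : b ^ k = h ^ ((i : ℤ) - j) := by
    rw [zpow_sub, zpow_natCast, zpow_natCast, eq_mul_inv_iff_mul_eq, ← mul_right_inj (h⁻¹ ^ i),
      ← mul_assoc, hx, inv_pow, inv_mul_cancel]
  have hij : i = j := by
    have h2 : Commute (h ^ ((i : ℤ) - j)) b := h1 ▸ (Commute.refl b).zpow_left k
    rcases le_total i j with hle | hle
    · have h3 : (i : ℤ) - j = -((j - i : ℕ) : ℤ) := by omega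
      rw [h3, zpow_neg, zpow_natCast, Commute.inv_left_iff] at h2
      have := hcomm _ h2
      omega
    · have h3 : (i : ℤ) - j = ((i - j : ℕ) : ℤ) := by omega
      rw [h3, zpow_natCast] at h2
      have := hcomm _ h2
      omega
  subst hij
  rw [sub_self, zpow_zero] at h1
  have hk : k = 0 := hinj (by simpa using h1)
  rw [hk, zpow_zero, mul_one, inv_pow, inv_mul_cancel]

end BaumslagSolitar

/-! ### Finite quotients and unbalanced elements -/

theorem gcd_orderOf_eq_of_conj_zpow {Q : Type*} [Group Q] {x y : Q} {m n : ℤ}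
    (hx : IsOfFinOrder x) (h : y * x ^ m * y⁻¹ = x ^ n) :
    Nat.gcd (orderOf x) m.natAbs = Nat.gcd (orderOf x) n.natAbs := by
  have horder : ∀ i : ℤ, orderOf (x ^ i) = orderOf (x ^ i.natAbs) := fun i => by
    obtain hi | hi := Int.natAbs_eq i
    · conv_lhs => rw [hi, zpow_natCast]
    · conv_lhs => rw [hi, zpow_neg, zpow_natCast, orderOf_inv]
  have h1 : orderOf (x ^ m) = orderOf (x ^ n) := by
    rw [← h]
    exact ((MulAut.conj y).orderOf_eq (x ^ m)).symm
  have hpos := hx.orderOf_pos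
  rw [horder, horder, hx.orderOf_pow, hx.orderOf_pow] at h1
  rw [← Nat.div_div_self (Nat.gcd_dvd_left (orderOf x) m.natAbs) hpos.ne', h1,
    Nat.div_div_self (Nat.gcd_dvd_left (orderOf x) n.natAbs) hpos.ne']

/-- In a finite group, `x ^ m` and `x ^ n` generate the same subgroup as soon as they are
conjugate, so that this subgroup contains `x ^ gcd m n`. -/
theorem commute_conj_zpow_gcd {Q : Type*} [Group Q] [Finite Q] {x y : Q} {m n : ℤ}
    (h : y * x ^ m * y⁻¹ = x ^ n) : Commute (y * x ^ (Int.gcd m n) * y⁻¹) x := by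
  have hx : IsOfFinOrder x := isOfFinOrder_of_finite x
  have hgcd := gcd_orderOf_eq_of_conj_zpow hx h
  set r := orderOf x
  have hdvd : Nat.gcd r m.natAbs ∣ Int.gcd m n :=
    Nat.dvd_gcd (Nat.gcd_dvd_right _ _) (hgcd ▸ Nat.gcd_dvd_right _ _)
  obtain ⟨c, hc⟩ := hdvd
  have hbez : ∃ v : ℤ, x ^ (Nat.gcd r m.natAbs) = (x ^ m) ^ v := by
    refine ⟨Int.gcdB r m, ?_⟩
    have h1 : ((Nat.gcd r m.natAbs : ℕ) : ℤ) = r * Int.gcdA r m + m * Int.gcdB r m := by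
      rw [← Int.gcd_eq_gcd_ab]
      rfl
    rw [← zpow_natCast, h1, zpow_add, zpow_mul, zpow_natCast, pow_orderOf_eq_one, one_zpow,
      one_mul, zpow_mul]
  obtain ⟨v, hv⟩ := hbez
  rw [hc, pow_mul, hv, ← conj_pow, ← conj_zpow, h]
  exact (((Commute.refl x).zpow_left n).zpow_left v).pow_left c

theorem Group.ResiduallyFinite.commute_conj_zpow_gcd {G : Type*} [Group G]
    (hG : Group.ResiduallyFinite G) {g h : G} {m n : ℤ} (hconj : h * g ^ m * h⁻¹ = g ^ n) :
    Commute (h * g ^ (Int.gcd m n) * h⁻¹) g := by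
  have key : (h * g ^ (Int.gcd m n) * h⁻¹) * g * (g * (h * g ^ (Int.gcd m n) * h⁻¹))⁻¹ = 1 := by
    refine Group.residuallyFinite_iff_forall_finiteIndexNormalSubgroup.mp hG _ fun N => ?_
    have : Finite (G ⧸ N.toSubgroup) := inferInstance
    set π := QuotientGroup.mk' N.toSubgroup
    have h1 : π h * π g ^ m * (π h)⁻¹ = π g ^ n := by
      rw [← map_zpow, ← map_zpow, ← hconj]
      simp
    have h2 := _root_.commute_conj_zpow_gcd h1
    have h3 : π ((h * g ^ (Int.gcd m n) * h⁻¹) * g * (g * (h * g ^ (Int.gcd m n) * h⁻¹))⁻¹) =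
        1 := by
      rw [map_mul, map_inv, mul_inv_eq_one, map_mul, map_mul, map_mul, map_mul, map_inv, map_pow]
      exact h2.eq
    exact (QuotientGroup.eq_one_iff _).mp h3
  exact mul_inv_eq_one.mp key

/-- Separating `⟨g ^ k⟩` for `k = m n` from the lower powers of `g` gives a finite quotient in which
`k` divides the order of `g`; there `g ^ m` and `g ^ n` have different orders. -/
theorem IsUnbalanced.not_isLERF {G : Type*} [Group G] {g : G} (hg : IsUnbalanced g) :
    ¬ IsLERF G := by
  obtain ⟨h, m, n, hu⟩ := hg
  intro hL
  have hinj : Function.Injective fun k : ℤ => g ^ k :=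
    injective_zpow_iff_not_isOfFinOrder.mpr hu.infinite_order
  set k : ℕ := (m * n).natAbs with hk
  have hkpos : 0 < k := Int.natAbs_pos.mpr (mul_ne_zero hu.left_ne_zero hu.right_ne_zero)
  have hsep : ∀ j : Fin k, ∃ K : Subgroup G, K.FiniteIndex ∧ g ^ k ∈ K ∧
      ((j : ℕ) ≠ 0 → g ^ (j : ℕ) ∉ K) := by
    intro j
    by_cases hj : (j : ℕ) = 0
    · exact ⟨⊤, inferInstance, Subgroup.mem_top _, fun h => absurd hj h⟩
    · have hfg : (Subgroup.zpowers (g ^ k)).FG := by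
        rw [Subgroup.zpowers_eq_closure]
        exact ⟨{g ^ k}, by simp⟩
      obtain ⟨K, hK1, hK2, hK3⟩ := hL _ hfg (g ^ (j : ℕ)) (by
        rintro ⟨i, hi⟩
        have h1 : (k : ℤ) * i = (j : ℕ) := hinj (by
          simpa only [zpow_mul, zpow_natCast] using hi)
        have h2 : k ∣ (j : ℕ) := Int.natCast_dvd_natCast.mp ⟨i, h1.symm⟩
        exact absurd (Nat.le_of_dvd (Nat.pos_of_ne_zero hj) h2) (not_le.mpr j.2))
      exact ⟨K, hK1, hK2 (Subgroup.mem_zpowers _), fun _ => hK3⟩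
  choose K hK1 hK2 hK3 using hsep
  set N : Subgroup G := (⨅ j, K j).normalCore
  have : (⨅ j, K j).FiniteIndex := Subgroup.finiteIndex_iInf hK1
  have hNK : ∀ j, N ≤ K j := fun j => (Subgroup.normalCore_le _).trans (iInf_le _ j)
  have : N.FiniteIndex := inferInstance
  have : Finite (G ⧸ N) := inferInstance
  set π := QuotientGroup.mk' N
  have hfin : IsOfFinOrder (π g) := isOfFinOrder_of_finite _
  have hdvd : k ∣ orderOf (π g) := by
    have hmem : g ^ orderOf (π g) ∈ N := by
      rw [← QuotientGroup.eq_one_iff]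
      exact (map_pow π g _).trans (pow_orderOf_eq_one _)
    rw [Nat.dvd_iff_mod_eq_zero]
    by_contra hne
    let j : Fin k := ⟨orderOf (π g) % k, Nat.mod_lt _ hkpos⟩
    refine hK3 j hne ?_
    have h1 := hNK j hmem
    rw [← Nat.mod_add_div (orderOf (π g)) k, pow_add, pow_mul] at h1
    exact (Subgroup.mul_mem_cancel_right _ (Subgroup.pow_mem _ (hK2 j) _)).mp h1
  have hgcd := gcd_orderOf_eq_of_conj_zpow (x := π g) (y := π h) hfin (m := m) (n := n) (by
    rw [← map_zpow, ← map_zpow, ← hu.conj]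
    simp)
  have hm : m.natAbs ∣ orderOf (π g) := (by
    rw [hk, Int.natAbs_mul]; exact Nat.dvd_mul_right _ _ : m.natAbs ∣ k).trans hdvd
  have hn : n.natAbs ∣ orderOf (π g) := (by
    rw [hk, Int.natAbs_mul]; exact Nat.dvd_mul_left _ _ : n.natAbs ∣ k).trans hdvd
  rw [Nat.gcd_eq_right hm, Nat.gcd_eq_right hn] at hgcd
  exact hu.abs_ne (by rw [Int.abs_eq_natAbs, Int.abs_eq_natAbs, hgcd])

namespace BaumslagSolitar

variable {p q : ℤ} {G : Type*} [Group G]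

theorem map_conj_a_zpow (f : BaumslagSolitar p q →* G) :
    f (t p q) * f (a p q) ^ p * (f (t p q))⁻¹ = f (a p q) ^ q := by
  rw [← map_zpow, ← map_zpow, ← map_inv, ← map_mul, ← map_mul, conj_a_zpow]

theorem not_isOfFinOrder_map_a (hp : p ≠ 0) (hq : q ≠ 0) {f : BaumslagSolitar p q →* G}
    (hf : Function.Injective f) : ¬ IsOfFinOrder (f (a p q)) := by
  rw [← injective_zpow_iff_not_isOfFinOrder]
  intro i j hij
  have h1 : a p q ^ i = a p q ^ j := hf (by rw [map_zpow, map_zpow]; exact hij)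
  have h2 : a p q ^ (i - j) = 1 := by rw [zpow_sub, h1, mul_inv_cancel]
  exact sub_eq_zero.mp (a_zpow_eq_one hp hq h2)

theorem isUnbalanced_of_embedsIn (hp : p ≠ 0) (hq : q ≠ 0) (hpq : |p| ≠ |q|)
    (h : EmbedsIn (BaumslagSolitar p q) G) : ∃ g : G, IsUnbalanced g := by
  obtain ⟨f, hf⟩ := h
  exact ⟨f (a p q), f (t p q), p, q, not_isOfFinOrder_map_a hp hq hf, hp, hq, hpq,
    map_conj_a_zpow f⟩

theorem isVeryUnbalanced_of_embedsIn (hp : p ≠ 0) (hq : q ≠ 0) (hp1 : |p| ≠ 1) (hq1 : |q| ≠ 1)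
    (hpq : |p| ≠ |q|) (h : EmbedsIn (BaumslagSolitar p q) G) : ∃ g : G, IsVeryUnbalanced g := by
  obtain ⟨f, hf⟩ := h
  refine ⟨f (a p q), f (t p q), p, q, not_isOfFinOrder_map_a hp hq hf, hp, hq, hp1, hq1, hpq,
    map_conj_a_zpow f, ?_, ?_⟩
  · rintro ⟨c, rfl⟩ hc
    rw [Int.mul_ediv_cancel_left _ hq, ← map_zpow, ← map_inv, ← map_mul, ← map_mul] at hc
    refine conj_notMem_zpowers hp hq (i := c) ?_ (by
      rw [hf hc]; exact Subgroup.mem_zpowers _)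
    intro hdvd
    have h1 : q ∣ 1 := by
      have hc0 : c ≠ 0 := right_ne_zero_of_mul hp
      exact (mul_dvd_mul_iff_right hc0).mp (by rwa [one_mul])
    exact hq1 (Int.isUnit_iff_abs_eq.mp (isUnit_of_dvd_one h1))
  · intro _ hc
    rw [← map_zpow, ← map_inv, ← map_mul, ← map_mul] at hc
    refine conj_notMem_zpowers hp hq (i := 1) ?_ ?_
    · exact fun hdvd => hp1 (Int.isUnit_iff_abs_eq.mp (isUnit_of_dvd_one hdvd))
    · rw [zpow_one, hf hc]
      exact Subgroup.zpow_mem _ (Subgroup.mem_zpowers _) _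

theorem not_residuallyFinite_of_embedsIn (hp : p ≠ 0) (hq : q ≠ 0) (hp1 : |p| ≠ 1)
    (hq1 : |q| ≠ 1) (hpq : |p| ≠ |q|) (h : EmbedsIn (BaumslagSolitar p q) G) :
    ¬ Group.ResiduallyFinite G := by
  obtain ⟨f, hf⟩ := h
  intro hG
  have hconj := map_conj_a_zpow f
  have hinv : (f (t p q))⁻¹ * f (a p q) ^ q * (f (t p q))⁻¹⁻¹ = f (a p q) ^ p := by
    rw [← hconj]; group
  have h1 := hG.commute_conj_zpow_gcd hconj
  have h2 := hG.commute_conj_zpow_gcd hinv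
  have hpd : p ∣ Int.gcd p q := by
    by_contra hnd
    refine not_commute_conj hp hq hq1 hnd (hf ?_)
    simpa only [map_mul, map_inv, map_pow, zpow_natCast] using h1.eq
  have hqd : q ∣ Int.gcd p q := by
    by_contra hnd
    refine not_commute_conj_inv hp hq hp1 hnd (hf ?_)
    simpa only [map_mul, map_inv, map_pow, zpow_natCast, inv_inv, Int.gcd_comm q p] using h2.eq
  have h3 : p ∣ q := hpd.trans (Int.gcd_dvd_right _ _)
  have h4 : q ∣ p := hqd.trans (Int.gcd_dvd_left _ _)
  exact hpq (by rw [Int.abs_eq_natAbs, Int.abs_eq_natAbs, Int.natAbs_eq_of_dvd_dvd h3 h4])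

end BaumslagSolitar

theorem IsVeryUnbalancedFor.symm {G : Type*} [Group G] {g h : G} {m n : ℤ}
    (H : IsVeryUnbalancedFor g h m n) : IsVeryUnbalancedFor g h⁻¹ n m where
  infinite_order := H.infinite_order
  left_ne_zero := H.right_ne_zero
  right_ne_zero := H.left_ne_zero
  left_abs_ne_one := H.right_abs_ne_one
  right_abs_ne_one := H.left_abs_ne_one
  abs_ne := H.abs_ne.symm
  conj := by rw [← H.conj]; group
  conj_ne_of_right_dvd hd hc := H.conj_ne_of_left_dvd hd (by
    calc h * g * h⁻¹ = h * (h⁻¹ * g ^ (n / m) * h⁻¹⁻¹) * h⁻¹ := by rw [hc]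
      _ = g ^ (n / m) := by group)
  conj_ne_of_left_dvd hd hc := H.conj_ne_of_right_dvd hd (by rw [← hc]; group)

/-- An unbalanced element that fails to be very unbalanced is conjugate to a proper power of
itself, by the given element or its inverse. -/
theorem IsUnbalancedFor.isVeryUnbalancedFor_or_embedsIn {G : Type*} [Group G] {g h : G} {m n : ℤ}
    (H : IsUnbalancedFor g h m n) :
    IsVeryUnbalancedFor g h m n ∨ ∃ l : ℤ, l ≠ 0 ∧ |l| ≠ 1 ∧ EmbedsIn (BaumslagSolitar 1 l) G := by
  have hm0 := H.left_ne_zero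
  have hn0 := H.right_ne_zero
  have hneg : ∀ {a b : ℤ}, b ≠ 0 → |a * b| ≠ |b| → |a| ≠ 1 := fun hb h ha => by
    rw [abs_mul, ha, one_mul] at h
    exact h rfl
  by_cases h1 : n ∣ m ∧ h * g ^ (m / n) * h⁻¹ = g
  · obtain ⟨⟨c, rfl⟩, h2⟩ := h1
    rw [Int.mul_ediv_cancel_left _ hn0] at h2
    refine Or.inr ⟨c, right_ne_zero_of_mul hm0, hneg hn0 (mul_comm n c ▸ H.abs_ne), ?_⟩
    refine BaumslagSolitar.embedsIn_of_conj_eq_zpow (b := g) (h := h⁻¹) H.infinite_order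
      (hneg hn0 (mul_comm n c ▸ H.abs_ne)) ?_
    calc h⁻¹ * g * h⁻¹⁻¹ = h⁻¹ * (h * g ^ c * h⁻¹) * h⁻¹⁻¹ := by rw [h2]
      _ = g ^ c := by group
  by_cases h2 : m ∣ n ∧ h * g * h⁻¹ = g ^ (n / m)
  · obtain ⟨⟨c, rfl⟩, h2⟩ := h2
    rw [Int.mul_ediv_cancel_left _ hm0] at h2
    have hc := hneg hm0 (mul_comm m c ▸ H.abs_ne.symm)
    exact Or.inr ⟨c, right_ne_zero_of_mul hn0, hc,
      BaumslagSolitar.embedsIn_of_conj_eq_zpow H.infinite_order hc h2⟩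
  refine Or.inl ⟨H.infinite_order, hm0, hn0, fun hm => h2 ?_, fun hn => h1 ?_, H.abs_ne, H.conj,
    fun hd hc => h1 ⟨hd, hc⟩, fun hd hc => h2 ⟨hd, hc⟩⟩
  · rcases (abs_eq zero_le_one).mp hm with rfl | rfl
    · have h4 := H.conj
      exact ⟨one_dvd _, by simpa using h4⟩
    · have h4 := H.conj
      refine ⟨⟨-n, by ring⟩, ?_⟩
      rw [zpow_neg, zpow_one, ← conj_inv, inv_eq_iff_eq_inv, ← zpow_neg] at h4
      simpa using h4
  · rcases (abs_eq zero_le_one).mp hn with rfl | rfl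
    · have h4 := H.conj
      exact ⟨one_dvd _, by simpa using h4⟩
    · have h4 := H.conj
      refine ⟨⟨-m, by ring⟩, ?_⟩
      rw [zpow_neg, zpow_one, ← inv_eq_iff_eq_inv, conj_inv, ← zpow_neg] at h4
      simpa using h4

/-! ### Unbalanced elements of groups acting on trees with free stabilizers -/

/-- If `m * x j = n * x (j + 1)` for a sequence of integers with `x 0 ≠ 0`, the part of `n` prime
to `m` divides `x 0` to every order, so it is a unit. -/
theorem Int.dvd_of_forall_mul_eq_mul_succ {m n : ℤ} (hn : n ≠ 0) {x : ℕ → ℤ} (hx : x 0 ≠ 0)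
    (h : ∀ j, m * x j = n * x (j + 1)) : n ∣ m := by
  obtain ⟨m', n', hcop, hm', hn'⟩ :=
    Int.exists_gcd_one (m := m) (n := n) (Int.gcd_pos_of_ne_zero_right _ hn)
  set e : ℤ := (Int.gcd m n : ℤ)
  have he : e ≠ 0 := fun he => hn (by rw [hn', he, mul_zero])
  have h' : ∀ j, m' * x j = n' * x (j + 1) := fun j => by
    have h1 := h j
    rw [hm', hn'] at h1
    apply mul_right_cancel₀ he
    linear_combination h1
  have hpow : ∀ k j : ℕ, n' ^ k ∣ x j := by
    intro k
    induction k with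
    | zero => simp
    | succ k ih =>
      intro j
      have h1 : n' ^ (k + 1) ∣ m' * x j := by
        rw [h', pow_succ']
        exact mul_dvd_mul_left _ (ih _)
      exact ((Int.isCoprime_iff_gcd_eq_one.mpr hcop).symm.pow_left).dvd_of_dvd_mul_left h1
  have hunit : n'.natAbs = 1 := by
    by_contra hne
    have hn0 : n' ≠ 0 := fun h0 => hn (by rw [hn', h0, zero_mul])
    have h2 : 1 < n'.natAbs := by omega
    have h3 : n'.natAbs ^ (x 0).natAbs ∣ (x 0).natAbs := by
      rw [← Int.natAbs_pow]
      exact Int.natAbs_dvd_natAbs.mpr (hpow _ 0)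
    exact absurd (Nat.le_of_dvd (Int.natAbs_pos.mpr hx) h3)
      (not_le.mpr (Nat.lt_pow_self h2))
  have hdvd : n' ∣ m' := (Int.isUnit_iff_natAbs_eq.mpr hunit).dvd
  rw [hm', hn']
  exact mul_dvd_mul_right hdvd e

section Stabilizer

variable {G X : Type*} [Group G] [MulAction G X] {x : X}
  [hfree : IsFreeGroup (MulAction.stabilizer G x)]

theorem abs_eq_of_conj_zpow_of_smul_eq {u z : G} (hu : u • x = x) (hz : z • x = x) (hz1 : z ≠ 1)
    {i j : ℤ} (hi : i ≠ 0) (hj : j ≠ 0) (h : u * z ^ i * u⁻¹ = z ^ j) : |i| = |j| := by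
  refine IsFreeGroup.abs_eq_of_conj_zpow (F := MulAction.stabilizer G x) (u := ⟨u, hu⟩)
    (z := ⟨z, hz⟩) ?_ hi hj (Subtype.ext (by simpa using h))
  exact fun h => hz1 (congrArg Subtype.val h)

theorem commute_of_commute_zpow_of_smul_eq {y z : G} (hy : y • x = x) (hz : z • x = x) {k : ℤ}
    (hk : k ≠ 0) (h : Commute y (z ^ k)) : Commute y z := by
  have := IsFreeGroup.isMulTorsionFree (MulAction.stabilizer G x)
  have h1 : Commute (⟨y, hy⟩ : MulAction.stabilizer G x) (⟨z, hz⟩ ^ k) :=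
    Subtype.ext (by simpa using h.eq)
  exact congrArg Subtype.val (commute_of_commute_zpow hk h1).eq

theorem exists_commute_iff_mem_zpowers_of_smul_eq {z : G} (hz : z • x = x) (hz1 : z ≠ 1) :
    ∃ a : G, a • x = x ∧ ∀ y : G, y • x = x → (Commute y z ↔ y ∈ Subgroup.zpowers a) := by
  obtain ⟨a, ha⟩ := IsFreeGroup.exists_commute_iff_mem_zpowers
    (F := MulAction.stabilizer G x) (z := ⟨z, hz⟩) (fun h => hz1 (congrArg Subtype.val h))
  refine ⟨a, a.2, fun y hy => ?_⟩
  have h1 : Commute y z ↔ Commute (⟨y, hy⟩ : MulAction.stabilizer G x) ⟨z, hz⟩ :=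
    ⟨fun h => Subtype.ext h.eq, fun h => congrArg Subtype.val h.eq⟩
  rw [h1, ha]
  constructor
  · rintro ⟨n, hn⟩
    exact ⟨n, by simpa using congrArg Subtype.val hn⟩
  · rintro ⟨n, hn⟩
    exact ⟨n, Subtype.ext (by simpa using hn)⟩

/-- If `g` fixes the ray `v, h • v, h ^ 2 • v, …`, the conjugates `h ^ (-j) * g * h ^ j` all lie in
the stabilizer of `v`, hence in one cyclic subgroup, and comparing exponents shows that `h⁻¹`
conjugates `g` to a power of itself. -/
theorem dvd_and_conj_eq_of_fixes_ray {g h : G} {m n : ℤ} (hg : ¬ IsOfFinOrder g) (hm : m ≠ 0)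
    (hn : n ≠ 0) (hconj : h * g ^ m * h⁻¹ = g ^ n) (hfix : ∀ j : ℕ, g • h ^ j • x = h ^ j • x) :
    n ∣ m ∧ h * g ^ (m / n) * h⁻¹ = g := by
  set γ : ℕ → G := fun j => (h ^ j)⁻¹ * g * h ^ j with hγ
  have hγ0 : γ 0 = g := by simp [hγ]
  have hγx : ∀ j, γ j • x = x := fun j => by
    rw [hγ, mul_smul, mul_smul, hfix, inv_smul_smul]
  have hstep : ∀ j, γ j ^ m = γ (j + 1) ^ n := by
    intro j
    have hz : ∀ (i : ℕ) (k : ℤ), γ i ^ k = (h ^ i)⁻¹ * g ^ k * h ^ i := fun i k => by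
      simpa using conj_zpow (a := (h ^ i)⁻¹) (b := g) (i := k)
    rw [hz, hz, ← hconj, pow_succ']
    group
  have hg1 : g ≠ 1 := fun h => hg (h ▸ IsOfFinOrder.one)
  have hgx : g • x = x := hγ0 ▸ hγx 0
  obtain ⟨a, -, ha⟩ := exists_commute_iff_mem_zpowers_of_smul_eq hgx hg1
  have hpow : ∀ j : ℕ, γ j ^ (n ^ j) = g ^ (m ^ j) := by
    intro j
    induction j with
    | zero => simp [hγ0]
    | succ j ih => rw [pow_succ' n, zpow_mul, ← hstep, ← zpow_mul, mul_comm, zpow_mul, ih,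
        ← zpow_mul, pow_succ]
  have hmem : ∀ j, ∃ i : ℤ, a ^ i = γ j := by
    intro j
    refine (ha _ (hγx j)).mp (commute_of_commute_zpow_of_smul_eq (hγx j) hgx (pow_ne_zero j hm) ?_)
    rw [← hpow]
    exact (Commute.refl _).zpow_right _
  choose e he using hmem
  have hainj : Function.Injective fun k : ℤ => a ^ k := by
    rw [injective_zpow_iff_not_isOfFinOrder]
    exact fun hfin => hg (by rw [← hγ0, ← he]; exact hfin.zpow)
  have he0 : e 0 ≠ 0 := fun h0 => hg1 (by rw [← hγ0, ← he, h0, zpow_zero])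
  have hrec : ∀ j, m * e j = n * e (j + 1) := fun j => hainj (by
    have h1 := hstep j
    rw [← he, ← he, ← zpow_mul, ← zpow_mul] at h1
    simpa only [mul_comm] using h1)
  have hdvd := Int.dvd_of_forall_mul_eq_mul_succ hn he0 hrec
  refine ⟨hdvd, ?_⟩
  obtain ⟨c, rfl⟩ := hdvd
  rw [Int.mul_ediv_cancel_left _ hn]
  have h1 : e 1 = e 0 * c := by
    have h2 := hrec 0
    rw [mul_assoc] at h2
    rw [← mul_left_cancel₀ hn h2, mul_comm]
  have h2 : γ 1 = g ^ c := by rw [← he, h1, zpow_mul, he, hγ0]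
  rw [← h2, hγ]
  group

end Stabilizer

namespace IsTreeDist

variable {G X : Type*} [Group G] [MulAction G X] {d : X → X → ℕ}

/-- If `e` and `e'` are the points at distance `D` from the fixed point `x` of `b` towards `c` and
`c'`, and `b` maps a point seen in the direction of `e` to one seen in the direction of `e'`, then
it maps `e` to `e'`. -/
theorem smul_eq_of_le_gromovProd (hd : IsTreeDist d)
    (hG : ∀ (g : G) (x y : X), d (g • x) (g • y) = d x y) {x c c' e e' z : X} {D : ℕ} {b : G}
    (hb : b • x = x) (he : d x e = D) (he' : d x e' = D) (hc : D ≤ gromovProd d x c e)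
    (hc' : D ≤ gromovProd d x c' e') (hz : D ≤ gromovProd d x c z)
    (hz' : D ≤ gromovProd d x c' (b • z)) : b • e = e' := by
  have h1 : D ≤ gromovProd d x e z :=
    hd.le_gromovProd_trans (by rwa [hd.gromovProd_comm]) hz
  have h2 : D ≤ gromovProd d x (b • e) (b • z) := by
    rwa [gromovProd_smul_of_smul_eq hG hb]
  have h3 : D ≤ gromovProd d x (b • z) e' :=
    hd.le_gromovProd_trans (by rwa [hd.gromovProd_comm]) hc'
  have h4 : d x (b • e) = D := by rw [← he, ← hG b x e, hb]
  have h5 := hd.le_gromovProd_trans h2 h3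
  exact hd.eq_of_le_gromovProd (by rwa [h4]) (by rwa [he'])

theorem le_gromovProd_zpow_smul (hd : IsTreeDist d)
    (hG : ∀ (g : G) (x y : X), d (g • x) (g • y) = d x y) {x z : X} {b : G} {D : ℕ}
    (hb : b • x = x) (hz : D ≤ gromovProd d x z (b • z)) (k : ℤ) :
    D ≤ gromovProd d x z (b ^ k • z) := by
  have hzz : D ≤ gromovProd d x z z := hd.le_gromovProd_trans hz (by rwa [hd.gromovProd_comm])
  induction k with
  | zero => simpa using hzz
  | succ k ih =>
    have h1 : D ≤ gromovProd d x (b • z) (b ^ ((k : ℤ) + 1) • z) := by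
      rwa [add_comm, zpow_add, zpow_one, mul_smul, gromovProd_smul_of_smul_eq hG hb]
    exact hd.le_gromovProd_trans hz h1
  | pred k ih =>
    have h1 : D ≤ gromovProd d x (b⁻¹ • z) (b ^ (-(k : ℤ) - 1) • z) := by
      rwa [sub_eq_add_neg, add_comm, zpow_add, zpow_neg_one, mul_smul,
        gromovProd_smul_of_smul_eq hG (inv_smul_eq_iff.mpr hb.symm)]
    have h2 : D ≤ gromovProd d x z (b⁻¹ • z) := by
      rwa [hd.gromovProd_comm, ← gromovProd_smul_of_smul_eq hG hb, smul_inv_smul]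
    exact hd.le_gromovProd_trans h2 h1

/-- Points that are carried far out by an isometry `h` translating the ray from `w` are seen from
`x` in the direction of `w`. -/
theorem exists_forall_one_le_gromovProd (hd : IsTreeDist d)
    (hG : ∀ (g : G) (x y : X), d (g • x) (g • y) = d x y) {h : G} {x w : X} {δ : ℕ} (hδ : δ ≠ 0)
    (hx : ∀ j : ℕ, d x (h ^ j • w) = d x w + j * δ) (hw : ∀ j : ℕ, d w (h ^ j • w) = j * δ)
    (hxw : d x w ≠ 0) (c : X) :
    ∃ N₀ : ℕ, ∀ N ≥ N₀, 1 ≤ gromovProd d x (h ^ N • c) w := by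
  refine ⟨d c w, fun N hN => hd.le_gromovProd_trans (y := h ^ N • w) ?_ ?_⟩
  · have h1 := hd.two_mul_gromovProd x (h ^ N • c) (h ^ N • w)
    have h2 := hd.triangle x (h ^ N • c) (h ^ N • w)
    rw [hG, hx] at h1 h2
    have h3 : N ≤ N * δ := Nat.le_mul_of_pos_right _ (by omega)
    omega
  · have h1 := hd.two_mul_gromovProd x (h ^ N • w) w
    have h2 := hx N
    have h3 := hw N
    have h4 := hd.symm w (h ^ N • w)
    omega

/-- Let `h` translate a ray from `w`, seen from `x`, and `h⁻¹` a ray from `w'`, seen from `y`, where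
`e` fixes `y` and moves the direction of `w'`. The geodesic from `h ^ (-N) • x` to
`e * h ^ (-N') • x` passes through `y`, so `h ^ N * e * h ^ (-N')` moves `x` in the direction
of `w`. -/
theorem exists_forall_one_le_gromovProd_turn (hd : IsTreeDist d)
    (hG : ∀ (g : G) (x y : X), d (g • x) (g • y) = d x y) {h e : G} {x y w w' : X} {δ δ' : ℕ}
    (hδ : δ ≠ 0) (hx : ∀ j : ℕ, d x (h ^ j • w) = d x w + j * δ)
    (hw : ∀ j : ℕ, d w (h ^ j • w) = j * δ) (hxw : d x w ≠ 0)
    (hδ' : δ' ≠ 0) (hy : ∀ j : ℕ, d y (h⁻¹ ^ j • w') = d y w' + j * δ')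
    (hw' : ∀ j : ℕ, d w' (h⁻¹ ^ j • w') = j * δ') (hyw' : d y w' ≠ 0)
    (hey : e • y = y) (he : gromovProd d y w' (e • w') = 0) :
    ∃ N₀ : ℕ, ∀ N ≥ N₀, ∀ N' ≥ N₀, 1 ≤ gromovProd d x ((h ^ N * e * h⁻¹ ^ N') • x) w := by
  obtain ⟨N₁, hN₁⟩ := hd.exists_forall_one_le_gromovProd hG hδ hx hw hxw y
  obtain ⟨N₂, hN₂⟩ := hd.exists_forall_one_le_gromovProd hG hδ' hy hw' hyw' x
  refine ⟨max N₁ N₂, fun N hN N' hN' => ?_⟩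
  have h1 := hN₁ N (by omega)
  have h2 := hN₂ N (by omega)
  have h3 := hN₂ N' (by omega)
  have h4 : gromovProd d y (h⁻¹ ^ N • x) (e • h⁻¹ ^ N' • x) = 0 := by
    by_contra hne
    have h5 : 1 ≤ gromovProd d y (e • h⁻¹ ^ N' • x) (e • w') := by
      rwa [gromovProd_smul_of_smul_eq hG hey]
    have h6 : 1 ≤ gromovProd d y w' (e • w') := by
      refine hd.le_gromovProd_trans (y := h⁻¹ ^ N • x) (by rwa [hd.gromovProd_comm]) ?_
      exact hd.le_gromovProd_trans (Nat.one_le_iff_ne_zero.mpr hne) h5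
    omega
  have h5 : gromovProd d (h ^ N • y) x ((h ^ N * e * h⁻¹ ^ N') • x) = 0 := by
    rw [← h4, ← gromovProd_smul hG (h ^ N) y, inv_pow h N, smul_inv_smul, mul_smul, mul_smul]
  have h6 := hd.gromovProd_add (h ^ N • y) x ((h ^ N * e * h⁻¹ ^ N') • x)
  have h7 := hd.gromovProd_le_left x (h ^ N • y) w
  refine hd.le_gromovProd_trans (y := h ^ N • y) ?_ h1
  rw [hd.gromovProd_comm]
  have h8 := hd.two_mul_gromovProd x (h ^ N • y) ((h ^ N * e * h⁻¹ ^ N') • x)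
  have h9 := hd.two_mul_gromovProd (h ^ N • y) x ((h ^ N * e * h⁻¹ ^ N') • x)
  have h10 := hd.symm x (h ^ N • y)
  omega

/-- An unbalanced element fixes a vertex, and the element conjugating its powers translates an
axis. -/
theorem exists_smul_eq_and_axis [Nonempty X] (hd : IsTreeDist d)
    (hG : ∀ (g : G) (x y : X), d (g • x) (g • y) = d x y)
    (hinv : ∀ (g : G) (z : X), g • g • z = z → Even (d z (g • z)))
    (hfree : ∀ x : X, IsFreeGroup (MulAction.stabilizer G x)) {g h : G} {m n : ℤ}
    (hg : ¬ IsOfFinOrder g) (hm : m ≠ 0) (hn : n ≠ 0) (hmn : |m| ≠ |n|)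
    (hconj : h * g ^ m * h⁻¹ = g ^ n) :
    ∃ o : X, g • o = o ∧ ∃ (v : X) (δ : ℕ), δ ≠ 0 ∧ ∀ j : ℕ, d v (h ^ j • v) = j * δ := by
  obtain ⟨o, ho⟩ : ∃ o : X, g • o = o := by
    rcases hd.fixed_point_or_axis hG g (hinv g) (Classical.arbitrary X) with
      ⟨z, hz, -⟩ | ⟨v, δ, hδ, hv⟩
    · exact ⟨z, hz⟩
    · exact absurd (hd.abs_eq_of_axis hG hconj hδ hv) hmn
  refine ⟨o, ho, (hd.fixed_point_or_axis hG h (hinv h) o).resolve_left ?_⟩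
  rintro ⟨z, hz, hbetween⟩
  have hgo : ∀ i : ℤ, g ^ i • o = o := fun i =>
    Subgroup.zpow_mem (MulAction.stabilizer G o) ho i
  have hgho : g ^ n • h • o = h • o := by
    rw [← hconj, mul_smul, mul_smul, inv_smul_smul, hgo]
  have hgz : g ^ n • z = z := hd.smul_eq_of_between hG (hgo n) hgho hbetween
  have hne : g ^ n ≠ 1 := fun h1 => hn ((injective_zpow_iff_not_isOfFinOrder.mpr hg)
    (by simpa using h1))
  have := hfree z
  refine hmn (abs_eq_of_conj_zpow_of_smul_eq hz hgz hne hm hn ?_)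
  rw [← zpow_mul, ← zpow_mul, mul_comm n m, zpow_mul, ← conj_zpow, hconj, ← zpow_mul]

/-- If `g` is not conjugated by `h⁻¹` to a power of itself, it moves the end of the axis of `h`:
the rays from `x` to `w` and to `g • w` part at the fixed point `x` of `g`. -/
theorem exists_moved_ray (hd : IsTreeDist d)
    (hG : ∀ (g : G) (x y : X), d (g • x) (g • y) = d x y)
    (hfree : ∀ x : X, IsFreeGroup (MulAction.stabilizer G x)) {g h : G} {m n : ℤ}
    (hg : ¬ IsOfFinOrder g) (hm : m ≠ 0) (hn : n ≠ 0)
    (hconj : h * g ^ m * h⁻¹ = g ^ n) (hne : n ∣ m → h * g ^ (m / n) * h⁻¹ ≠ g) {o v : X} {δ : ℕ}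
    (ho : g • o = o) (hδ : δ ≠ 0) (hv : ∀ j : ℕ, d v (h ^ j • v) = j * δ) :
    ∃ x w : X, g • x = x ∧ gromovProd d x w (g • w) = 0 ∧ d x w ≠ 0 ∧
      (∀ j : ℕ, d x (h ^ j • w) = d x w + j * δ) ∧ ∀ j : ℕ, d w (h ^ j • w) = j * δ := by
  obtain ⟨u, hu⟩ := hd.exists_ray_of_axis hG hδ hv o
  obtain ⟨i, hi⟩ : ∃ i : ℕ, g • h ^ i • u ≠ h ^ i • u := by
    by_contra! hfix
    have := hfree u
    obtain ⟨h1, h2⟩ := dvd_and_conj_eq_of_fixes_ray hg hm hn hconj hfix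
    exact hne h1 h2
  set w := h ^ i • u with hwdef
  have hw : ∀ j : ℕ, d w (h ^ j • w) = j * δ := fun j => by
    rw [hwdef, smul_smul, ← pow_add, add_comm, pow_add, mul_smul, hG, (hu j).2]
  obtain ⟨x, hx, hox, hxw⟩ := hd.exists_last_fixed hG (w := w) ho
  refine ⟨x, w, hx, hxw, ?_, fun j => ?_, hw⟩
  · intro h0
    obtain rfl := hd.eq_of_zero h0
    exact hi hx
  · have h1 : d o (h ^ j • w) = d o w + j * δ := by
      rw [hwdef, smul_smul, ← pow_add, (hu _).1, (hu _).1]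
      ring
    have h2 := hd.triangle o x (h ^ j • w)
    have h3 := hd.triangle x w (h ^ j • w)
    have h4 := hw j
    omega

end IsTreeDist

/-! ### Baumslag-Solitar subgroups by ping-pong on the tree -/

/-- The powers of `a` that fix a point are the powers of a single one. -/
theorem exists_zpow_smul_eq_iff_dvd {G X : Type*} [Group G] [MulAction G X] (a : G) (y : X) :
    ∃ q : ℤ, ∀ i : ℤ, a ^ i • y = y ↔ q ∣ i := by
  let I : AddSubgroup ℤ :=
    { carrier := {i | a ^ i ∈ MulAction.stabilizer G y}
      zero_mem' := by simp
      add_mem' := fun {i j} hi hj => by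
        simp only [Set.mem_ofPred_eq, zpow_add] at hi hj ⊢
        exact mul_mem hi hj
      neg_mem' := fun {i} hi => by
        simp only [Set.mem_ofPred_eq, zpow_neg] at hi ⊢
        exact inv_mem hi }
  obtain ⟨q, hq⟩ := Int.subgroup_cyclic I
  refine ⟨q, fun i => ?_⟩
  rw [← Int.mem_zmultiples_iff, AddSubgroup.zmultiples_eq_closure, ← hq]
  rfl

namespace IsTreeDist

variable {G X : Type*} [Group G] [MulAction G X] {d : X → X → ℕ}

/-- Suppose `s` is an unbalanced conjugator for `g`, that `g` fixes `x`, and that `g` moves the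
initial edges of the geodesics from `x` to `s • x` and to `s⁻¹ • x`. Let `a` generate the
centralizer of `g` in the stabilizer of `x`, and put `k = s a s⁻¹ a s`. The geodesic from `x` to
`k • x` consists of three translates of the one from `x` to `s • x`, and a power of `a` fixing the
first of them commutes with the turns made at its ends, hence fixes all three. Ping-pong shows that
`a` and `k` generate a Baumslag-Solitar group. -/
theorem exists_embedsIn_of_turns (hd : IsTreeDist d)
    (hG : ∀ (g : G) (x y : X), d (g • x) (g • y) = d x y)
    (hfree : ∀ x : X, IsFreeGroup (MulAction.stabilizer G x)) {g s : G} {x : X} {i₀ j₀ : ℤ}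
    (hg : ¬ IsOfFinOrder g) (hi₀ : i₀ ≠ 0) (hj₀ : j₀ ≠ 0) (hij : |i₀| ≠ |j₀|)
    (hconj : s * g ^ i₀ * s⁻¹ = g ^ j₀) (hgx : g • x = x)
    (hs : gromovProd d x (s • x) (g • s • x) = 0)
    (hs' : gromovProd d x (s⁻¹ • x) (g • s⁻¹ • x) = 0) :
    ∃ p q : ℤ, p ≠ 0 ∧ q ≠ 0 ∧ |p| ≠ 1 ∧ |q| ≠ 1 ∧ |p| ≠ |q| ∧
      EmbedsIn (BaumslagSolitar p q) G := by
  have := hfree x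
  have hginj : Function.Injective fun k : ℤ => g ^ k :=
    injective_zpow_iff_not_isOfFinOrder.mpr hg
  have hg1 : g ≠ 1 := fun h => hg (h ▸ IsOfFinOrder.one)
  have hconj' : s⁻¹ * g ^ j₀ * s = g ^ i₀ := by rw [← hconj]; group
  obtain ⟨a, hax, ha⟩ := exists_commute_iff_mem_zpowers_of_smul_eq hgx hg1
  obtain ⟨r, hr⟩ : ∃ r : ℤ, a ^ r = g := (ha g hgx).mp (Commute.refl g)
  have hainj : Function.Injective fun k : ℤ => a ^ k := by
    rw [injective_zpow_iff_not_isOfFinOrder]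
    exact fun hfin => hg (hr ▸ hfin.zpow)
  have hr0 : r ≠ 0 := fun h0 => hg1 (by rw [← hr, h0, zpow_zero])
  have haxz : ∀ i : ℤ, a ^ i • x = x := fun i =>
    Subgroup.zpow_mem (MulAction.stabilizer G x) hax i
  have hcomm : ∀ i j : ℤ, Commute (a ^ i) (g ^ j) := fun i j =>
    (((ha (a ^ i) (haxz i)).mpr ⟨i, rfl⟩)).zpow_right j
  set D := d x (s • x) with hD
  have hD' : d x (s⁻¹ • x) = D := by rw [← hG s, smul_inv_smul, hd.symm]
  have hDpos : D ≠ 0 := by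
    intro h0
    have hsx : s • x = x := (hd.eq_of_zero h0).symm
    exact hij (abs_eq_of_conj_zpow_of_smul_eq hsx hgx hg1 hi₀ hj₀ hconj)
  -- `a` inherits from `g` that it moves the initial edges
  have hturn : ∀ z : X, gromovProd d x z (g • z) = 0 → gromovProd d x z (a • z) = 0 := by
    intro z hz
    by_contra hne
    have h1 := hd.le_gromovProd_zpow_smul hG hax (Nat.one_le_iff_ne_zero.mpr hne) r
    rw [hr] at h1
    omega
  have has := hturn _ hs
  have has' := hturn _ hs'
  obtain ⟨q, hq⟩ := exists_zpow_smul_eq_iff_dvd a (s • x)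
  have hq0 : q ≠ 0 := by
    rintro rfl
    have h1 : a ^ (r * j₀) • s • x = s • x := by
      rw [zpow_mul, hr, ← hconj, mul_smul, mul_smul, inv_smul_smul, ← hr, ← zpow_mul, haxz]
    exact mul_ne_zero hr0 hj₀ (zero_dvd_iff.mp ((hq _).mp h1))
  obtain ⟨p, hp⟩ : ∃ p : ℤ, a ^ p = s⁻¹ * a ^ q * s := by
    have hfix : (s⁻¹ * a ^ q * s) • x = x := by
      rw [mul_smul, mul_smul, (hq q).mpr dvd_rfl, inv_smul_smul]
    refine (ha _ hfix).mp (commute_of_commute_zpow_of_smul_eq hfix hgx hi₀ ?_)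
    rw [← hconj']
    simpa using (hcomm q j₀).conj s⁻¹
  have hconja : s * a ^ p * s⁻¹ = a ^ q := by rw [hp]; group
  have hp0 : p ≠ 0 := by
    rintro rfl
    rw [zpow_zero, mul_one, mul_inv_cancel] at hconja
    exact hq0 (hainj (by simpa using hconja.symm))
  have hpdvd : ∀ i : ℤ, a ^ i • s⁻¹ • x = s⁻¹ • x → p ∣ i := by
    intro i hi
    have hfix : (s * a ^ i * s⁻¹) • x = x := by
      rw [mul_smul, mul_smul, hi, smul_inv_smul]
    obtain ⟨l, hl⟩ : ∃ l : ℤ, a ^ l = s * a ^ i * s⁻¹ := by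
      refine (ha _ hfix).mp (commute_of_commute_zpow_of_smul_eq hfix hgx hj₀ ?_)
      rw [← hconj]
      exact (hcomm i i₀).conj s
    have hlfix : a ^ l • s • x = s • x := by
      rw [hl, mul_smul, mul_smul, inv_smul_smul, haxz]
    obtain ⟨c, rfl⟩ := (hq l).mp hlfix
    refine ⟨c, hainj ?_⟩
    have h1 : s * a ^ (p * c) * s⁻¹ = s * a ^ i * s⁻¹ := by
      rw [← hl, zpow_mul, ← conj_zpow, hconja, ← zpow_mul]
    exact (mul_left_cancel (mul_right_cancel h1)).symm
  have hpfix : a ^ p • s⁻¹ • x = s⁻¹ • x := by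
    rw [hp, mul_smul, mul_smul, smul_inv_smul, haxz]
  have hself : ∀ z : X, gromovProd d x z z = d x z := fun z => by
    have h1 := hd.two_mul_gromovProd x z z
    rw [hd.self] at h1
    omega
  have hunit : ∀ (z : X) (l : ℤ), a ^ l • z = z → |l| = 1 → a • z = z := by
    intro z l hz hl
    rcases (abs_eq zero_le_one).mp hl with rfl | rfl
    · simpa using hz
    · rw [zpow_neg, zpow_one, inv_smul_eq_iff] at hz
      exact hz.symm
  have hp1 : |p| ≠ 1 := by
    intro h1
    rw [hunit _ _ hpfix h1, hself] at has'
    omega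
  have hq1 : |q| ≠ 1 := by
    intro h1
    rw [hunit _ _ ((hq q).mpr dvd_rfl) h1, hself] at has
    omega
  have hpq : |p| ≠ |q| := by
    intro h1
    have h2 : q * (r * i₀) = r * j₀ * p := hainj (by
      show a ^ (q * (r * i₀)) = a ^ (r * j₀ * p)
      rw [zpow_mul, ← hconja, conj_zpow, ← zpow_mul, mul_comm p, zpow_mul, zpow_mul, hr,
        ← conj_zpow, hconj, zpow_mul, zpow_mul, hr])
    have h3 : q * i₀ = j₀ * p := mul_left_cancel₀ hr0 (by linear_combination h2)
    have h4 := congrArg abs h3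
    rw [abs_mul, abs_mul, h1, mul_comm] at h4
    exact hij (mul_right_cancel₀ (abs_ne_zero.mpr hq0) h4)
  refine ⟨p, q, hp0, hq0, hp1, hq1, hpq, ?_⟩
  set k : G := s * a * s⁻¹ * a * s with hk
  have hkconj : k * a ^ p * k⁻¹ = a ^ q := by
    calc k * a ^ p * k⁻¹ = s * a * s⁻¹ * a * (s * a ^ p * s⁻¹) * a⁻¹ * s * a⁻¹ * s⁻¹ := by
          rw [hk]; group
      _ = s * (a * (s⁻¹ * a ^ q * s) * a⁻¹) * s⁻¹ := by rw [hconja]; group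
      _ = s * a ^ p * s⁻¹ := by rw [← hp]; group
      _ = a ^ q := hconja
  have hda : ∀ z : X, d x (a • z) = d x z := fun z => by rw [← hG a x z, hax]
  -- the geodesic from `x` to `k • x`
  have h01 : d (s • x) ((s * a * s⁻¹) • x) = D := by
    rw [mul_smul, mul_smul, hG, hda, hD']
  have h12 : d ((s * a * s⁻¹) • x) (k • x) = D := by
    rw [hk, mul_assoc _ a s, mul_smul _ (a * s), hG, mul_smul, hda]
  have h02 : d x ((s * a * s⁻¹) • x) = 2 * D := by
    have h1 := hd.two_mul_gromovProd x (s⁻¹ • x) (a • s⁻¹ • x)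
    have h2 : d (s⁻¹ • x) (a • s⁻¹ • x) = d x ((s * a * s⁻¹) • x) := by
      rw [← hG s, smul_inv_smul, mul_smul, mul_smul]
    have h3 := hda (s⁻¹ • x)
    omega
  have h13 : d (s • x) (k • x) = 2 * D := by
    have h1 := hd.two_mul_gromovProd x (s • x) (a • s • x)
    have h2 : d (s • x) (k • x) = d (s • x) (a • s • x) := by
      rw [← hG (s * a * s⁻¹) (s • x) (a • s • x), hk]
      congr 1
      · rw [smul_smul, inv_mul_cancel_right, mul_smul, hax]
      · rw [smul_smul, smul_smul]
    have h3 := hda (s • x)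
    omega
  have h03 : d x (k • x) = 3 * D := by
    rw [hd.dist_concat (b := s • x) (c := (s * a * s⁻¹) • x) (by omega) (by omega) (by omega)]
    omega
  have hk1 : d x (k⁻¹ • x) = 3 * D := by rw [← hG k, smul_inv_smul, hd.symm, h03]
  have hkpos : D ≤ gromovProd d x (k • x) (s • x) := by
    have h1 := hd.two_mul_gromovProd x (k • x) (s • x)
    have h2 := hd.symm (s • x) (k • x)
    omega
  have hkneg : D ≤ gromovProd d x (k⁻¹ • x) (s⁻¹ • x) := by
    have h1 := hd.two_mul_gromovProd x (k⁻¹ • x) (s⁻¹ • x)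
    have h2 : d (k⁻¹ • x) (s⁻¹ • x) = d x ((s * a * s⁻¹) • x) := by
      rw [← hG k, smul_inv_smul, hk, smul_smul, mul_inv_cancel_right, mul_smul _ a, hax]
    omega
  -- no power of `a` exchanges the two directions, as `s * a ^ i * s` is again unbalanced
  have hswap : ∀ (i : ℤ) (z : X), 2 * D ≤ gromovProd d x (k • x) z →
      D + 1 ≤ gromovProd d x (k⁻¹ • x) (a ^ i • z) → False := by
    intro i z hz hz'
    have h1 : a ^ i • s • x = s⁻¹ • x :=
      hd.smul_eq_of_le_gromovProd hG (z := z) (haxz i) hD.symm hD' hkpos hkneg (by omega) (by omega)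
    have h2 : (s * a ^ i * s) • x = x := by rw [mul_smul, mul_smul, h1, smul_inv_smul]
    have h3 : (s * a ^ i * s) * g ^ (i₀ * i₀) * (s * a ^ i * s)⁻¹ = g ^ (j₀ * j₀) := by
      calc (s * a ^ i * s) * g ^ (i₀ * i₀) * (s * a ^ i * s)⁻¹
          = s * (a ^ i * (s * g ^ i₀ * s⁻¹) ^ i₀ * (a ^ i)⁻¹) * s⁻¹ := by
            rw [conj_zpow, ← zpow_mul]; group
        _ = s * g ^ (i₀ * j₀) * s⁻¹ := by
            rw [hconj, ← zpow_mul, (hcomm i _).eq, mul_inv_cancel_right, mul_comm j₀]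
        _ = g ^ (j₀ * j₀) := by rw [zpow_mul, ← conj_zpow, hconj, zpow_mul]
    have h4 := abs_eq_of_conj_zpow_of_smul_eq h2 hgx hg1 (mul_ne_zero hi₀ hi₀)
      (mul_ne_zero hj₀ hj₀) h3
    rw [abs_mul, abs_mul] at h4
    exact hij ((mul_self_inj (abs_nonneg _) (abs_nonneg _)).mp h4)
  refine ⟨BaumslagSolitar.lift a k hkconj,
    BaumslagSolitar.lift_injective_of_ping_pong hp0 hq0 hkconj (fun i hi => hainj (by simpa using hi))
      (fun u => if u = 1 then {z | 2 * D ≤ gromovProd d x (k • x) z}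
        else {z | D + 1 ≤ gromovProd d x (k⁻¹ • x) z}) x hax ?_ ?_ ?_ ?_⟩
  · have h0 : ∀ z, gromovProd d x z x = 0 := fun z => by
      have h1 := hd.gromovProd_le_right x z x
      rw [hd.self] at h1
      omega
    intro u
    rcases Int.units_eq_one_or u with rfl | rfl
    · simp only [if_pos, Set.mem_ofPred_eq, h0]
      omega
    · simp [h0]
  · intro u z
    rcases Int.units_eq_one_or u with rfl | rfl
    · intro hz
      have h1 := hd.gromovProd_add x (k⁻¹ • x) z
      have h2 : gromovProd d x (k • x) (k • z) = gromovProd d (k⁻¹ • x) x z := by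
        rw [← gromovProd_smul hG k (k⁻¹ • x), smul_inv_smul]
      have h3 : ¬ D + 1 ≤ gromovProd d x (k⁻¹ • x) z := by simpa using hz
      simp only [if_pos, Set.mem_ofPred_eq, Units.val_one, zpow_one, h2]
      omega
    · intro hz
      have h1 := hd.gromovProd_add x (k • x) z
      have h2 : gromovProd d x (k⁻¹ • x) (k⁻¹ • z) = gromovProd d (k • x) x z := by
        rw [← gromovProd_smul hG k⁻¹ (k • x), inv_smul_smul]
      have h3 : ¬ 2 * D ≤ gromovProd d x (k • x) z := by simpa using hz
      simp
      omega
  · intro u i z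
    rcases Int.units_eq_one_or u with rfl | rfl
    · intro hz hz'
      exact hswap i z (by simpa using hz) (by simpa using hz')
    · intro hz hz'
      refine hswap (-i) (a ^ i • z) (by simpa using hz') ?_
      rw [zpow_neg, inv_smul_smul]
      simpa using hz
  · intro u i z
    rcases Int.units_eq_one_or u with rfl | rfl
    · intro hz hz'
      have h1 : D + 1 ≤ gromovProd d x (k⁻¹ • x) z := by simpa using hz
      have h2 : D + 1 ≤ gromovProd d x (k⁻¹ • x) (a ^ i • z) := by simpa using hz'
      exact hpdvd i (hd.smul_eq_of_le_gromovProd hG (z := z) (haxz i) hD' hD' hkneg hkneg (by omega)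
        (by omega))
    · intro hz hz'
      have h1 : 2 * D ≤ gromovProd d x (k • x) z := by simpa using hz
      have h2 : 2 * D ≤ gromovProd d x (k • x) (a ^ i • z) := by simpa using hz'
      exact (hq i).mp (hd.smul_eq_of_le_gromovProd hG (z := z) (haxz i) hD.symm hD.symm hkpos hkpos
        (by omega) (by omega))

/-- A group acting without inversions on a tree with free vertex stabilizers that contains a very
unbalanced element contains `BS(p, q)` for some `p` and `q` with `1`, `|p|`, `|q|` distinct. The
element `s = h ^ N * g * h ^ (-N - 1)` goes out along the axis of `h`, turns around, and comes back,
so that both `s • x` and `s⁻¹ • x` are seen from `x` in the direction of the attracting end of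
`h`. -/
theorem exists_embedsIn_of_isVeryUnbalanced [Nonempty X] (hd : IsTreeDist d)
    (hG : ∀ (g : G) (x y : X), d (g • x) (g • y) = d x y)
    (hinv : ∀ (g : G) (z : X), g • g • z = z → Even (d z (g • z)))
    (hfree : ∀ x : X, IsFreeGroup (MulAction.stabilizer G x)) {g : G} (hg : IsVeryUnbalanced g) :
    ∃ p q : ℤ, p ≠ 0 ∧ q ≠ 0 ∧ |p| ≠ 1 ∧ |q| ≠ 1 ∧ |p| ≠ |q| ∧
      EmbedsIn (BaumslagSolitar p q) G := by
  obtain ⟨h, m, n, H⟩ := hg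
  have H' := H.symm
  have hm := H.left_ne_zero
  have hn := H.right_ne_zero
  obtain ⟨o, ho, v, δ, hδ, hv⟩ := hd.exists_smul_eq_and_axis hG hinv hfree H.infinite_order hm hn
    H.abs_ne H.conj
  obtain ⟨o', ho', v', δ', hδ', hv'⟩ := hd.exists_smul_eq_and_axis hG hinv hfree H.infinite_order hn
    hm H'.abs_ne H'.conj
  obtain ⟨x, w, hgx, hgw, hxw, hx, hw⟩ := hd.exists_moved_ray hG hfree H.infinite_order hm hn H.conj
    H.conj_ne_of_right_dvd ho hδ hv
  obtain ⟨y, w', hgy, hgw', hyw', hy, hw'⟩ := hd.exists_moved_ray hG hfree H.infinite_order hn hm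
    H'.conj H'.conj_ne_of_right_dvd ho' hδ' hv'
  have hgy' : g⁻¹ • y = y := inv_smul_eq_iff.mpr hgy.symm
  have hgw'' : gromovProd d y w' (g⁻¹ • w') = 0 := by
    rw [hd.gromovProd_comm, ← gromovProd_smul_of_smul_eq hG hgy, smul_inv_smul, hgw']
  obtain ⟨N₁, hN₁⟩ := hd.exists_forall_one_le_gromovProd_turn hG hδ hx hw hxw hδ' hy hw' hyw' hgy
    hgw'
  obtain ⟨N₂, hN₂⟩ := hd.exists_forall_one_le_gromovProd_turn hG hδ hx hw hxw hδ' hy hw' hyw' hgy'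
    hgw''
  set N := max N₁ N₂
  set s : G := h ^ N * g * h⁻¹ ^ (N + 1) with hs
  have hsinv : s⁻¹ = h ^ (N + 1) * g⁻¹ * h⁻¹ ^ N := by rw [hs]; group
  have hsw : 1 ≤ gromovProd d x (s • x) w := hN₁ N (by omega) (N + 1) (by omega)
  have hsw' : 1 ≤ gromovProd d x (s⁻¹ • x) w := by
    rw [hsinv]
    exact hN₂ (N + 1) (by omega) N (by omega)
  have hturn : ∀ z, 1 ≤ gromovProd d x z w → gromovProd d x z (g • z) = 0 := by
    intro z hz
    by_contra hne
    have h1 : 1 ≤ gromovProd d x (g • z) (g • w) := by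
      rwa [gromovProd_smul_of_smul_eq hG hgx]
    have h2 : 1 ≤ gromovProd d x w (g • w) := by
      refine hd.le_gromovProd_trans (y := z) (by rwa [hd.gromovProd_comm]) ?_
      exact hd.le_gromovProd_trans (Nat.one_le_iff_ne_zero.mpr hne) h1
    omega
  have hpow : ∀ i : ℕ, h ^ i * g ^ (m ^ i) * (h ^ i)⁻¹ = g ^ (n ^ i) := by
    intro i
    induction i with
    | zero => simp
    | succ i ih =>
      have h1 : h ^ (i + 1) * g ^ (m ^ (i + 1)) * (h ^ (i + 1))⁻¹ =
          h * (h ^ i * g ^ (m ^ i) * (h ^ i)⁻¹) ^ m * h⁻¹ := by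
        rw [conj_zpow, ← zpow_mul, ← pow_succ, pow_succ' h]
        group
      rw [h1, ih, ← zpow_mul, mul_comm, zpow_mul, ← conj_zpow, H.conj, ← zpow_mul, pow_succ']
  refine hd.exists_embedsIn_of_turns hG hfree (s := s) (i₀ := n ^ (N + 1)) (j₀ := m * n ^ N)
    H.infinite_order (pow_ne_zero _ hn) (mul_ne_zero hm (pow_ne_zero _ hn)) ?_ ?_ hgx
    (hturn _ hsw) (hturn _ hsw')
  · rw [pow_succ', abs_mul, abs_mul]
    intro h1
    exact H.abs_ne (mul_right_cancel₀ (abs_ne_zero.mpr (pow_ne_zero _ hn)) h1).symm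
  · have h1 : h⁻¹ ^ (N + 1) * g ^ (n ^ (N + 1)) * h ^ (N + 1) = g ^ (m ^ (N + 1)) := by
      rw [← hpow]; group
    calc s * g ^ (n ^ (N + 1)) * s⁻¹
        = h ^ N * (g * (h⁻¹ ^ (N + 1) * g ^ (n ^ (N + 1)) * h ^ (N + 1)) * g⁻¹) * (h ^ N)⁻¹ := by
          rw [hs]; group
      _ = h ^ N * (g ^ (m ^ N)) ^ m * (h ^ N)⁻¹ := by
          rw [h1, ← zpow_mul, ← pow_succ]; group
      _ = g ^ (m * n ^ N) := by rw [← conj_zpow, hpow, ← zpow_mul, mul_comm]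

end IsTreeDist

/-! ### Tree distances from families of lists -/

section CommonPrefix

variable {α : Type*}

open Classical in
/-- The length of the longest common prefix of two lists. -/
noncomputable def commonPrefixLength : List α → List α → ℕ
  | a :: l, b :: m => if a = b then commonPrefixLength l m + 1 else 0
  | _, _ => 0

theorem commonPrefixLength_comm (l m : List α) :
    commonPrefixLength l m = commonPrefixLength m l := by
  induction l generalizing m with
  | nil => cases m <;> rfl
  | cons a l ih =>
    cases m with
    | nil => rfl
    | cons b m =>
      by_cases h : a = b
      · simp [commonPrefixLength, h, ih m]
      · simp [commonPrefixLength, h, Ne.symm h]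

theorem commonPrefixLength_take (l m : List α) (k : ℕ) :
    commonPrefixLength (l.take k) m = min k (commonPrefixLength l m) := by
  induction l generalizing m k with
  | nil => simp [commonPrefixLength]
  | cons a l ih =>
    cases k with
    | zero => simp [commonPrefixLength]
    | succ k =>
      cases m with
      | nil => simp [commonPrefixLength]
      | cons b m =>
        simp only [commonPrefixLength, List.take_succ_cons, ih m k]
        split_ifs <;> omega

theorem commonPrefixLength_self (l : List α) : commonPrefixLength l l = l.length := by
  induction l with
  | nil => rfl
  | cons a l ih => simp [commonPrefixLength, ih]

theorem commonPrefixLength_le_left (l m : List α) : commonPrefixLength l m ≤ l.length := by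
  have h := commonPrefixLength_take l m l.length
  rw [List.take_length] at h
  omega

theorem take_commonPrefixLength (l m : List α) :
    l.take (commonPrefixLength l m) = m.take (commonPrefixLength l m) := by
  induction l generalizing m with
  | nil => simp [commonPrefixLength]
  | cons a l ih =>
    cases m with
    | nil => simp [commonPrefixLength]
    | cons b m =>
      simp only [commonPrefixLength]
      split_ifs with h
      · rw [List.take_succ_cons, List.take_succ_cons, h, ih]
      · rfl

theorem le_commonPrefixLength_trans {l m n : List α} {k : ℕ} (h₁ : k ≤ commonPrefixLength l m)
    (h₂ : k ≤ commonPrefixLength m n) : k ≤ commonPrefixLength l n := by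
  have h3 : l.take k = m.take k := by
    have h := congrArg (List.take k) (take_commonPrefixLength l m)
    rwa [List.take_take, List.take_take, min_eq_left h₁] at h
  have h4 := commonPrefixLength_take l n k
  rw [h3, commonPrefixLength_take] at h4
  omega

/-- The distance of two lists in the tree where each list is joined to its tail. -/
noncomputable def listDist (l m : List α) : ℕ :=
  l.length + m.length - 2 * commonPrefixLength l.reverse m.reverse

theorem listDist_add (l m : List α) :
    listDist l m + 2 * commonPrefixLength l.reverse m.reverse = l.length + m.length := by
  have h1 := commonPrefixLength_le_left l.reverse m.reverse
  have h2 := commonPrefixLength_le_left m.reverse l.reverse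
  rw [commonPrefixLength_comm] at h2
  rw [List.length_reverse] at h1 h2
  unfold listDist
  omega

theorem listDist_cons (a : α) (l : List α) : listDist l (a :: l) = 1 := by
  have h1 := listDist_add l (a :: l)
  have h2 := commonPrefixLength_take (a :: l).reverse (a :: l).reverse l.length
  rw [commonPrefixLength_self, List.reverse_cons, List.take_left' (by simp)] at h2
  simp only [List.length_append, List.length_reverse, List.length_cons, List.length_nil] at h2
  rw [List.reverse_cons, h2, List.length_cons] at h1
  omega

theorem listDist_comm (l m : List α) : listDist l m = listDist m l := by
  simp only [listDist, commonPrefixLength_comm, Nat.add_comm]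

theorem exists_eq_cons_of_listDist_eq_one {l m : List α} (h : listDist l m = 1) :
    (∃ a, m = a :: l) ∨ ∃ a, l = a :: m := by
  wlog hle : l.length ≤ m.length generalizing l m
  · exact (this (by rwa [listDist_comm]) (by omega)).symm
  left
  have h1 := listDist_add l m
  have h2 := commonPrefixLength_le_left l.reverse m.reverse
  rw [List.length_reverse] at h2
  have h3 := take_commonPrefixLength l.reverse m.reverse
  have h4 : commonPrefixLength l.reverse m.reverse = l.length := by omega
  rw [h4, List.take_of_length_le (by simp)] at h3
  have h5 : m.length = l.length + 1 := by omega
  cases m with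
  | nil => simp at h5
  | cons a m =>
    refine ⟨a, ?_⟩
    have h6 : m.length = l.length := by simpa using h5
    rw [List.reverse_cons, ← h6, List.take_left' (by simp)] at h3
    rw [List.reverse_injective h3]

/-- A set of lists closed under passing to suffixes is the vertex set of a tree, each list being
joined to its tail. -/
theorem isTreeDist_listDist {X : Type*} {f : X → List α} (hf : Function.Injective f)
    (hsuff : ∀ (x : X) (l : List α), l <:+ f x → ∃ y, f y = l) :
    IsTreeDist fun x y => listDist (f x) (f y) where
  self x := by
    have h1 := listDist_add (f x) (f x)
    rw [commonPrefixLength_self, List.length_reverse] at h1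
    omega
  eq_of_zero {x y} h := by
    have h1 := listDist_add (f x) (f y)
    have h2 := commonPrefixLength_le_left (f x).reverse (f y).reverse
    have h3 := commonPrefixLength_le_left (f y).reverse (f x).reverse
    rw [commonPrefixLength_comm] at h3
    rw [List.length_reverse] at h2 h3
    have h4 := take_commonPrefixLength (f x).reverse (f y).reverse
    rw [List.take_of_length_le (by rw [List.length_reverse]; omega),
      List.take_of_length_le (by rw [List.length_reverse]; omega)] at h4
    exact hf (List.reverse_injective h4)
  symm x y := listDist_comm _ _
  even_perimeter x y z := by
    have h1 := listDist_add (f x) (f y)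
    have h2 := listDist_add (f y) (f z)
    have h3 := listDist_add (f x) (f z)
    rw [Nat.even_iff]
    omega
  four_point x y z w := by
    have key : ∀ a b c : X,
        min (commonPrefixLength (f a).reverse (f b).reverse)
          (commonPrefixLength (f b).reverse (f c).reverse) ≤
        commonPrefixLength (f a).reverse (f c).reverse := fun a b c =>
      le_commonPrefixLength_trans (min_le_left _ _) (min_le_right _ _)
    have h1 := listDist_add (f x) (f y)
    have h2 := listDist_add (f x) (f z)
    have h3 := listDist_add (f x) (f w)
    have h4 := listDist_add (f y) (f z)
    have h5 := listDist_add (f y) (f w)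
    have h6 := listDist_add (f z) (f w)
    have k1 := key x y z
    have k2 := key x w z
    have k3 := key y x w
    have k4 := key y z w
    have k5 := key x z w
    have k6 := key x z y
    have k7 := key y x z
    have k8 := key y w z
    have k9 := key x y w
    have k10 := key x w y
    have k11 := key z x w
    have k12 := key z y w
    rw [commonPrefixLength_comm (f w).reverse] at k2 k8 k10
    rw [commonPrefixLength_comm (f z).reverse] at k6
    rw [commonPrefixLength_comm (f y).reverse (f x).reverse] at k3 k7
    rw [commonPrefixLength_comm (f z).reverse (f x).reverse] at k11
    rw [commonPrefixLength_comm (f z).reverse (f y).reverse] at k12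
    omega
  exists_point {x y k} hk := by
    set L := (f x).reverse with hL
    set M := (f y).reverse with hM
    have hLl : L.length = (f x).length := List.length_reverse
    have hMl : M.length = (f y).length := List.length_reverse
    have h1 := listDist_add (f x) (f y)
    rw [← hL, ← hM] at h1
    have h2 := commonPrefixLength_le_left L M
    have h3 := commonPrefixLength_le_left M L
    have h3' := commonPrefixLength_comm M L
    rcases Nat.le_total k ((f x).length - commonPrefixLength L M) with hle | hle
    · obtain ⟨z, hz⟩ := hsuff x (L.take ((f x).length - k)).reverse (by
        rw [← List.reverse_prefix, List.reverse_reverse]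
        exact List.take_prefix _ _)
      have h4 := listDist_add (f x) (f z)
      have h5 := listDist_add (f z) (f y)
      have h6 := commonPrefixLength_take L L ((f x).length - k)
      have h7 := commonPrefixLength_take L M ((f x).length - k)
      rw [commonPrefixLength_comm, commonPrefixLength_self] at h6
      have h8 : (f z).reverse = L.take ((f x).length - k) := by rw [hz, List.reverse_reverse]
      have h9 : (f z).length = (f x).length - k := by
        rw [← List.length_reverse, h8, List.length_take]; omega
      rw [← hL, h8] at h4
      rw [← hM, h8] at h5
      exact ⟨z, by omega, by omega⟩
    · set j := (f y).length + k - listDist (f x) (f y) with hj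
      obtain ⟨z, hz⟩ := hsuff y (M.take j).reverse (by
        rw [← List.reverse_prefix, List.reverse_reverse]
        exact List.take_prefix _ _)
      have h4 := listDist_add (f x) (f z)
      have h5 := listDist_add (f z) (f y)
      have h6 := commonPrefixLength_take M M j
      have h7 := commonPrefixLength_take M L j
      rw [commonPrefixLength_self] at h6
      rw [commonPrefixLength_comm] at h7
      have h8 : (f z).reverse = M.take j := by rw [hz, List.reverse_reverse]
      have h9 : (f z).length = j := by
        rw [← List.length_reverse, h8, List.length_take]; omega
      rw [← hL, h8] at h4
      rw [← hM, h8] at h5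
      exact ⟨z, by omega, by omega⟩

end CommonPrefix

/-! ### The tree of the path group of a graph of groups -/

section RightCosetRepresentative

variable {B C : Type*} [Group B] [Group C] (φ : C →* B)

open Classical in
/-- A chosen representative of the right coset of `b` modulo the range of `φ`; it is `1` for the
trivial coset. -/
noncomputable def rightRep (b : B) : B :=
  if b ∈ φ.range then 1
  else Quotient.out (Quotient.mk (QuotientGroup.rightRel φ.range) b)

theorem rightRep_map_mul (c : C) (b : B) : rightRep φ (φ c * b) = rightRep φ b := by
  have h1 : φ c * b ∈ φ.range ↔ b ∈ φ.range := φ.range.mul_mem_cancel_left ⟨c, rfl⟩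
  have h2 : Quotient.mk (QuotientGroup.rightRel φ.range) (φ c * b) =
      Quotient.mk (QuotientGroup.rightRel φ.range) b := by
    refine Quotient.sound (QuotientGroup.rightRel_apply.mpr ⟨c⁻¹, ?_⟩)
    rw [map_inv]
    group
  classical exact if_congr h1 rfl (congrArg _ h2)

theorem exists_map_mul_rightRep (b : B) : ∃ c, φ c * rightRep φ b = b := by
  unfold rightRep
  split_ifs with h
  · obtain ⟨c, rfl⟩ := h
    exact ⟨c, mul_one _⟩
  · obtain ⟨c, hc⟩ := QuotientGroup.rightRel_apply.mp
      (Quotient.mk_out (s := QuotientGroup.rightRel φ.range) b)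
    exact ⟨c, by rw [hc, inv_mul_cancel_right]⟩

/-- The element `c` with `φ c * rightRep φ b = b`. -/
noncomputable def rightCoef (b : B) : C :=
  (exists_map_mul_rightRep φ b).choose

theorem map_rightCoef_mul (b : B) : φ (rightCoef φ b) * rightRep φ b = b :=
  (exists_map_mul_rightRep φ b).choose_spec

theorem rightRep_rightRep (b : B) : rightRep φ (rightRep φ b) = rightRep φ b := by
  conv_rhs => rw [← map_rightCoef_mul φ b, rightRep_map_mul]

theorem rightRep_map (c : C) : rightRep φ (φ c) = 1 :=
  if_pos ⟨c, rfl⟩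

variable {φ}

theorem rightCoef_map_mul (hφ : Function.Injective φ) (c : C) (b : B) :
    rightCoef φ (φ c * b) = c * rightCoef φ b := by
  apply hφ
  apply mul_right_cancel (b := rightRep φ b)
  rw [map_mul, mul_assoc, map_rightCoef_mul]
  conv_lhs => rw [← rightRep_map_mul φ c b, map_rightCoef_mul]

theorem rightCoef_eq_one (hφ : Function.Injective φ) {b : B} (hb : rightRep φ b = b) :
    rightCoef φ b = 1 := by
  apply hφ
  have h := map_rightCoef_mul φ b
  rwa [hb, mul_eq_right, ← map_one φ] at h

theorem rightCoef_map (hφ : Function.Injective φ) (c : C) : rightCoef φ (φ c) = c := by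
  have h := map_rightCoef_mul φ (φ c)
  rw [rightRep_map, mul_one] at h
  exact hφ h

end RightCosetRepresentative

namespace GraphOfGroups

variable {V E : Type*} (𝒢 : GraphOfGroups V E)

/-- The free product of the vertex groups. The path group is an HNN extension of it, with one
stable letter for each edge. -/
abbrev VertexProd : Type _ := Monoid.CoprodI 𝒢.vertexGroup

/-- The edge group of `e` in the free product of the vertex groups, placed at the target of `e` for
`true` and at its source for `false`. -/
def edgeHom (e : E) : Bool → (𝒢.edgeGroup e →* 𝒢.VertexProd)
  | true => Monoid.CoprodI.of.comp (𝒢.tgtHom e)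
  | false => Monoid.CoprodI.of.comp (𝒢.srcHom e)

theorem edgeHom_injective (e : E) (b : Bool) : Function.Injective (𝒢.edgeHom e b) := by
  cases b
  · exact Monoid.CoprodI.of_injective _ |>.comp (𝒢.srcHom_injective e)
  · exact Monoid.CoprodI.of_injective _ |>.comp (𝒢.tgtHom_injective e)

/-- The free product of the vertex groups mapped to the path group. -/
def ofVertexProd : 𝒢.VertexProd →* 𝒢.PathGroup :=
  (QuotientGroup.mk' (Subgroup.normalClosure 𝒢.relators)).comp Monoid.Coprod.inl

/-- The letter `t_e` for `true`, and its inverse for `false`. -/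
def letter (e : E) : Bool → 𝒢.PathGroup
  | true => 𝒢.ofEdge e
  | false => (𝒢.ofEdge e)⁻¹

theorem letter_not (e : E) (b : Bool) : 𝒢.letter e (!b) = (𝒢.letter e b)⁻¹ := by
  cases b
  · exact (inv_inv _).symm
  · rfl

theorem letter_mul_edgeHom (e : E) (b : Bool) (c : 𝒢.edgeGroup e) :
    𝒢.letter e b * 𝒢.ofVertexProd (𝒢.edgeHom e b c) =
      𝒢.ofVertexProd (𝒢.edgeHom e (!b) c) * 𝒢.letter e b := by
  have h : 𝒢.ofEdge e * 𝒢.ofVertexProd (𝒢.edgeHom e true c) * (𝒢.ofEdge e)⁻¹ *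
      (𝒢.ofVertexProd (𝒢.edgeHom e false c))⁻¹ = 1 :=
    (QuotientGroup.eq_one_iff _).mpr (Subgroup.subset_normalClosure ⟨e, c, rfl⟩)
  rw [mul_inv_eq_one, mul_inv_eq_iff_eq_mul] at h
  cases b
  · change (𝒢.ofEdge e)⁻¹ * _ = 𝒢.ofVertexProd (𝒢.edgeHom e true c) * (𝒢.ofEdge e)⁻¹
    rw [inv_mul_eq_iff_eq_mul, ← mul_assoc, h, mul_inv_cancel_right]
  · exact h

theorem closure_eq_top {S : Subgroup 𝒢.PathGroup} (hB : ∀ b, 𝒢.ofVertexProd b ∈ S)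
    (ht : ∀ e, 𝒢.ofEdge e ∈ S) : S = ⊤ := by
  have h1 : S.comap (QuotientGroup.mk' (Subgroup.normalClosure 𝒢.relators)) = ⊤ := by
    rw [eq_top_iff, ← Monoid.Coprod.range_inl_sup_range_inr, sup_le_iff]
    refine ⟨?_, ?_⟩
    · rintro _ ⟨b, rfl⟩
      exact hB b
    · rw [MonoidHom.range_eq_map, ← FreeGroup.closure_range_of, MonoidHom.map_closure,
        Subgroup.closure_le]
      rintro _ ⟨_, ⟨e, rfl⟩, rfl⟩
      exact ht e
  rw [eq_top_iff]
  intro p _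
  obtain ⟨q, rfl⟩ := QuotientGroup.mk'_surjective _ p
  exact (h1.symm ▸ Subgroup.mem_top q :
    q ∈ S.comap (QuotientGroup.mk' (Subgroup.normalClosure 𝒢.relators)))

/-- Lists `[(t₁, r₁), …, (tₖ, rₖ)]`, where each `tᵢ` is a letter and `rᵢ` is the chosen
representative of its coset, such that the word `t₁ r₁ ⋯ tₖ rₖ` contains no `tᵢ 1 tᵢ⁻¹`. -/
def IsReduced : List ((E × Bool) × 𝒢.VertexProd) → Prop
  | [] => True
  | ((e, b), r) :: l => rightRep (𝒢.edgeHom e b) r = r ∧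
      (r = 1 → ∀ r' l', l ≠ ((e, !b), r') :: l') ∧ IsReduced l

variable {𝒢} in
theorem IsReduced.of_suffix {l m : List ((E × Bool) × 𝒢.VertexProd)} (hm : 𝒢.IsReduced m)
    (h : l <:+ m) : 𝒢.IsReduced l := by
  induction m with
  | nil => rw [List.suffix_nil.mp h]; trivial
  | cons x m ih =>
    rcases List.suffix_cons_iff.mp h with rfl | h
    · exact hm
    · exact ih hm.2.2 h

open Classical in
/-- Left multiplication by a letter, on pairs `(g, l)` standing for an element of the free product of
the vertex groups followed by a list as in `IsReduced`. -/
noncomputable def letterAct (e : E) (b : Bool) :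
    𝒢.VertexProd × List ((E × Bool) × 𝒢.VertexProd) →
      𝒢.VertexProd × List ((E × Bool) × 𝒢.VertexProd)
  | (g, []) => (𝒢.edgeHom e (!b) (rightCoef (𝒢.edgeHom e b) g),
      [((e, b), rightRep (𝒢.edgeHom e b) g)])
  | (g, (y, r) :: l) =>
    if rightRep (𝒢.edgeHom e b) g = 1 ∧ y = (e, !b) then
      (𝒢.edgeHom e (!b) (rightCoef (𝒢.edgeHom e b) g) * r, l)
    else (𝒢.edgeHom e (!b) (rightCoef (𝒢.edgeHom e b) g),
      ((e, b), rightRep (𝒢.edgeHom e b) g) :: (y, r) :: l)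

theorem letterAct_cancel {e : E} {b : Bool} {g : 𝒢.VertexProd}
    (hg : rightRep (𝒢.edgeHom e b) g = 1) (r : 𝒢.VertexProd)
    (l : List ((E × Bool) × 𝒢.VertexProd)) :
    𝒢.letterAct e b (g, ((e, !b), r) :: l) =
      (𝒢.edgeHom e (!b) (rightCoef (𝒢.edgeHom e b) g) * r, l) :=
  if_pos ⟨hg, rfl⟩

theorem letterAct_push {e : E} {b : Bool} {g : 𝒢.VertexProd}
    {l : List ((E × Bool) × 𝒢.VertexProd)}
    (h : rightRep (𝒢.edgeHom e b) g = 1 → ∀ r' l', l ≠ ((e, !b), r') :: l') :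
    𝒢.letterAct e b (g, l) = (𝒢.edgeHom e (!b) (rightCoef (𝒢.edgeHom e b) g),
      ((e, b), rightRep (𝒢.edgeHom e b) g) :: l) := by
  match l with
  | [] => rfl
  | (y, r) :: l =>
    refine if_neg fun hc => h hc.1 r l ?_
    rw [hc.2]

/-- A letter either cancels against the first letter of a list or is put in front of it. -/
theorem letterAct_cases (e : E) (b : Bool) (g : 𝒢.VertexProd)
    (l : List ((E × Bool) × 𝒢.VertexProd)) :
    (rightRep (𝒢.edgeHom e b) g = 1 ∧ ∃ r l', l = ((e, !b), r) :: l') ∨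
      (rightRep (𝒢.edgeHom e b) g = 1 → ∀ r' l', l ≠ ((e, !b), r') :: l') := by
  by_cases h : rightRep (𝒢.edgeHom e b) g = 1 ∧ ∃ r l', l = ((e, !b), r) :: l'
  · exact Or.inl h
  · exact Or.inr fun h1 r l' h2 => h ⟨h1, r, l', h2⟩

theorem isReduced_letterAct (e : E) (b : Bool) {g : 𝒢.VertexProd}
    {l : List ((E × Bool) × 𝒢.VertexProd)} (hl : 𝒢.IsReduced l) :
    𝒢.IsReduced (𝒢.letterAct e b (g, l)).2 := by
  rcases 𝒢.letterAct_cases e b g l with ⟨h, r, l, rfl⟩ | h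
  · rw [letterAct_cancel 𝒢 h]
    exact hl.2.2
  · rw [letterAct_push 𝒢 h]
    exact ⟨rightRep_rightRep _ _, h, hl⟩

theorem letterAct_letterAct (e : E) (b : Bool) {g : 𝒢.VertexProd}
    {l : List ((E × Bool) × 𝒢.VertexProd)} (hl : 𝒢.IsReduced l) :
    𝒢.letterAct e (!b) (𝒢.letterAct e b (g, l)) = (g, l) := by
  have hg := map_rightCoef_mul (𝒢.edgeHom e b) g
  rcases 𝒢.letterAct_cases e b g l with ⟨h, r, l, rfl⟩ | h
  · obtain ⟨hr, hl, -⟩ := hl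
    rw [letterAct_cancel 𝒢 h, letterAct_push]
    · rw [rightRep_map_mul, rightCoef_map_mul (𝒢.edgeHom_injective e _), hr,
        rightCoef_eq_one (𝒢.edgeHom_injective e _) hr, mul_one, Bool.not_not]
      rw [h, mul_one] at hg
      rw [hg]
    · rwa [rightRep_map_mul, hr]
  · rw [letterAct_push 𝒢 h]
    have h1 := 𝒢.letterAct_cancel (e := e) (b := !b)
      (g := 𝒢.edgeHom e (!b) (rightCoef (𝒢.edgeHom e b) g)) (rightRep_map _ _)
      (rightRep (𝒢.edgeHom e b) g) l
    rw [Bool.not_not, rightCoef_map (𝒢.edgeHom_injective e _), hg] at h1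
    exact h1

theorem letterAct_edgeHom_mul (e : E) (b : Bool) (c : 𝒢.edgeGroup e) (g : 𝒢.VertexProd)
    (l : List ((E × Bool) × 𝒢.VertexProd)) :
    𝒢.letterAct e b (𝒢.edgeHom e b c * g, l) =
      (𝒢.edgeHom e (!b) c * (𝒢.letterAct e b (g, l)).1, (𝒢.letterAct e b (g, l)).2) := by
  rcases 𝒢.letterAct_cases e b g l with ⟨h, r, l, rfl⟩ | h
  · rw [letterAct_cancel 𝒢 h, letterAct_cancel 𝒢 (by rwa [rightRep_map_mul]),
      rightCoef_map_mul (𝒢.edgeHom_injective e b), map_mul, mul_assoc]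
  · rw [letterAct_push 𝒢 h, letterAct_push 𝒢 (by rwa [rightRep_map_mul]),
      rightCoef_map_mul (𝒢.edgeHom_injective e b), map_mul, rightRep_map_mul]

/-- The normal forms of the elements of the path group. -/
def NormalForm : Type _ :=
  {w : 𝒢.VertexProd × List ((E × Bool) × 𝒢.VertexProd) // 𝒢.IsReduced w.2}

/-- The normal form of `1`. -/
def NormalForm.one : 𝒢.NormalForm := ⟨(1, []), trivial⟩

/-- Left multiplication of normal forms by elements of the vertex groups. -/
def vertexPerm : 𝒢.VertexProd →* Equiv.Perm 𝒢.NormalForm where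
  toFun g :=
    { toFun := fun w => ⟨(g * w.1.1, w.1.2), w.2⟩
      invFun := fun w => ⟨(g⁻¹ * w.1.1, w.1.2), w.2⟩
      left_inv := fun w => Subtype.ext (Prod.ext (inv_mul_cancel_left g w.1.1) rfl)
      right_inv := fun w => Subtype.ext (Prod.ext (mul_inv_cancel_left g w.1.1) rfl) }
  map_one' := Equiv.ext fun w => Subtype.ext (Prod.ext (one_mul w.1.1) rfl)
  map_mul' g h := Equiv.ext fun w => Subtype.ext (Prod.ext (mul_assoc g h w.1.1) rfl)

/-- Left multiplication of normal forms by a letter `t_e`. -/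
noncomputable def edgePerm (e : E) : Equiv.Perm 𝒢.NormalForm where
  toFun w := ⟨𝒢.letterAct e true w.1, 𝒢.isReduced_letterAct e true w.2⟩
  invFun w := ⟨𝒢.letterAct e false w.1, 𝒢.isReduced_letterAct e false w.2⟩
  left_inv w := Subtype.ext (𝒢.letterAct_letterAct e true w.2)
  right_inv w := Subtype.ext (𝒢.letterAct_letterAct e false w.2)

theorem edgePerm_mul_vertexPerm (e : E) (c : 𝒢.edgeGroup e) :
    𝒢.edgePerm e * 𝒢.vertexPerm (𝒢.edgeHom e true c) =
      𝒢.vertexPerm (𝒢.edgeHom e false c) * 𝒢.edgePerm e :=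
  Equiv.ext fun w => Subtype.ext (𝒢.letterAct_edgeHom_mul e true c w.1.1 w.1.2)

/-- The action of the path group on normal forms by left multiplication. -/
noncomputable def normalFormPerm : 𝒢.PathGroup →* Equiv.Perm 𝒢.NormalForm :=
  QuotientGroup.lift _ (Monoid.Coprod.lift 𝒢.vertexPerm (FreeGroup.lift 𝒢.edgePerm)) (by
    refine Subgroup.normalClosure_le_normal ?_
    rintro _ ⟨e, c, rfl⟩
    have h := 𝒢.edgePerm_mul_vertexPerm e c
    simp only [edgeHom, MonoidHom.comp_apply] at h
    simp only [SetLike.mem_coe, MonoidHom.mem_ker, map_mul, map_inv, Monoid.Coprod.lift_apply_inl,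
      Monoid.Coprod.lift_apply_inr, FreeGroup.lift_apply_of]
    rw [h, mul_inv_cancel_right, mul_inv_cancel])

theorem normalFormPerm_ofVertexProd (g : 𝒢.VertexProd) :
    𝒢.normalFormPerm (𝒢.ofVertexProd g) = 𝒢.vertexPerm g :=
  Monoid.Coprod.lift_apply_inl 𝒢.vertexPerm (FreeGroup.lift 𝒢.edgePerm) g

theorem normalFormPerm_ofEdge (e : E) : 𝒢.normalFormPerm (𝒢.ofEdge e) = 𝒢.edgePerm e := by
  refine (Monoid.Coprod.lift_apply_inr 𝒢.vertexPerm (FreeGroup.lift 𝒢.edgePerm)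
    (FreeGroup.of e)).trans ?_
  exact FreeGroup.lift_apply_of

theorem normalFormPerm_letter_val (e : E) (b : Bool) (w : 𝒢.NormalForm) :
    (𝒢.normalFormPerm (𝒢.letter e b) w).1 = 𝒢.letterAct e b w.1 := by
  cases b
  · rw [letter, map_inv, normalFormPerm_ofEdge]
    rfl
  · rw [letter, normalFormPerm_ofEdge]
    rfl

/-- The element of the path group described by an element of the free product of the vertex groups
and a list of letters and representatives. -/
def wordProd (w : 𝒢.VertexProd × List ((E × Bool) × 𝒢.VertexProd)) : 𝒢.PathGroup :=
  𝒢.ofVertexProd w.1 *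
    (w.2.map fun x => 𝒢.letter x.1.1 x.1.2 * 𝒢.ofVertexProd x.2).prod

theorem wordProd_cons (g r : 𝒢.VertexProd) (e : E) (b : Bool)
    (l : List ((E × Bool) × 𝒢.VertexProd)) :
    𝒢.wordProd (g, ((e, b), r) :: l) =
      𝒢.ofVertexProd g * (𝒢.letter e b * 𝒢.wordProd (r, l)) := by
  simp only [wordProd, List.map_cons, List.prod_cons, mul_assoc]

theorem wordProd_mul (g h : 𝒢.VertexProd) (l : List ((E × Bool) × 𝒢.VertexProd)) :
    𝒢.wordProd (g * h, l) = 𝒢.ofVertexProd g * 𝒢.wordProd (h, l) := by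
  simp only [wordProd, map_mul, mul_assoc]

theorem wordProd_letterAct (e : E) (b : Bool) (g : 𝒢.VertexProd)
    (l : List ((E × Bool) × 𝒢.VertexProd)) :
    𝒢.wordProd (𝒢.letterAct e b (g, l)) = 𝒢.letter e b * 𝒢.wordProd (g, l) := by
  have hg := map_rightCoef_mul (𝒢.edgeHom e b) g
  rcases 𝒢.letterAct_cases e b g l with ⟨h, r, l, rfl⟩ | h
  · rw [h, mul_one] at hg
    rw [letterAct_cancel 𝒢 h, wordProd_mul, wordProd_cons]
    nth_rw 2 [← hg]
    rw [← mul_assoc, letter_mul_edgeHom, letter_not, mul_assoc, mul_inv_cancel_left]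
  · rw [letterAct_push 𝒢 h, wordProd_cons, ← mul_assoc, ← letter_mul_edgeHom, mul_assoc,
      ← wordProd_mul, hg]

theorem wordProd_normalFormPerm (p : 𝒢.PathGroup) (w : 𝒢.NormalForm) :
    𝒢.wordProd (𝒢.normalFormPerm p w).1 = p * 𝒢.wordProd w.1 := by
  let S : Subgroup 𝒢.PathGroup :=
    { carrier := {p | ∀ w : 𝒢.NormalForm,
        𝒢.wordProd (𝒢.normalFormPerm p w).1 = p * 𝒢.wordProd w.1}
      one_mem' := fun w => by rw [map_one, one_mul]; rfl
      mul_mem' := fun {p q} hp hq w => by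
        rw [map_mul, Equiv.Perm.mul_apply, hp, hq, mul_assoc]
      inv_mem' := fun {p} hp w => by
        rw [eq_inv_mul_iff_mul_eq, ← hp, ← Equiv.Perm.mul_apply, ← map_mul, mul_inv_cancel, map_one,
          Equiv.Perm.one_apply] }
  have hS : S = ⊤ := by
    refine 𝒢.closure_eq_top (fun g w => ?_) fun e w => ?_
    · rw [normalFormPerm_ofVertexProd]
      exact 𝒢.wordProd_mul g w.1.1 w.1.2
    · exact (congrArg 𝒢.wordProd (𝒢.normalFormPerm_letter_val e true w)).trans
        (𝒢.wordProd_letterAct e true w.1.1 w.1.2)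
  exact (hS.symm ▸ Subgroup.mem_top p : p ∈ S) w

theorem normalFormPerm_wordProd (g : 𝒢.VertexProd) {l : List ((E × Bool) × 𝒢.VertexProd)}
    (hl : 𝒢.IsReduced l) :
    𝒢.normalFormPerm (𝒢.wordProd (g, l)) (NormalForm.one 𝒢) = ⟨(g, l), hl⟩ := by
  induction l generalizing g with
  | nil =>
    have h : 𝒢.wordProd (g, []) = 𝒢.ofVertexProd g := mul_one _
    rw [h, normalFormPerm_ofVertexProd]
    exact Subtype.ext (Prod.ext (mul_one g) rfl)
  | cons x l ih =>
    obtain ⟨⟨e, b⟩, r⟩ := x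
    obtain ⟨hr, hne, hl'⟩ := hl
    rw [wordProd_cons, map_mul, map_mul, Equiv.Perm.mul_apply, Equiv.Perm.mul_apply, ih r hl',
      normalFormPerm_ofVertexProd]
    have h1 := 𝒢.normalFormPerm_letter_val e b ⟨(r, l), hl'⟩
    rw [letterAct_push 𝒢 (by rwa [hr]), hr, rightCoef_eq_one (𝒢.edgeHom_injective e b) hr,
      map_one] at h1
    have h2 : 𝒢.normalFormPerm (𝒢.letter e b) ⟨(r, l), hl'⟩ =
        ⟨(1, ((e, b), r) :: l), ⟨hr, hne, hl'⟩⟩ := Subtype.ext h1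
    rw [h2]
    exact Subtype.ext (Prod.ext (mul_one g) rfl)

theorem ofVertexProd_injective : Function.Injective 𝒢.ofVertexProd := by
  intro g h hgh
  have h1 := congrArg (fun p => (𝒢.normalFormPerm p (NormalForm.one 𝒢)).1.1) hgh
  simp only [normalFormPerm_ofVertexProd] at h1
  exact mul_right_cancel h1

/-- The list in the normal form of `p`. It determines the coset of `p` modulo left multiplication by
the free product of the vertex groups. -/
noncomputable def normalList (p : 𝒢.PathGroup) : List ((E × Bool) × 𝒢.VertexProd) :=
  (𝒢.normalFormPerm p (NormalForm.one 𝒢)).1.2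

theorem isReduced_normalList (p : 𝒢.PathGroup) : 𝒢.IsReduced (𝒢.normalList p) :=
  (𝒢.normalFormPerm p (NormalForm.one 𝒢)).2

theorem exists_eq_wordProd (p : 𝒢.PathGroup) :
    ∃ g, p = 𝒢.wordProd (g, 𝒢.normalList p) := by
  have h : 𝒢.wordProd (NormalForm.one 𝒢).1 = 1 := by
    simp [wordProd, NormalForm.one]
  refine ⟨(𝒢.normalFormPerm p (NormalForm.one 𝒢)).1.1, ?_⟩
  have h1 := 𝒢.wordProd_normalFormPerm p (NormalForm.one 𝒢)
  rw [h, mul_one] at h1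
  exact h1.symm

theorem normalList_wordProd (g : 𝒢.VertexProd) {l : List ((E × Bool) × 𝒢.VertexProd)}
    (hl : 𝒢.IsReduced l) : 𝒢.normalList (𝒢.wordProd (g, l)) = l := by
  rw [normalList, normalFormPerm_wordProd 𝒢 g hl]

theorem normalList_ofVertexProd_mul (g : 𝒢.VertexProd) (p : 𝒢.PathGroup) :
    𝒢.normalList (𝒢.ofVertexProd g * p) = 𝒢.normalList p := by
  rw [normalList, map_mul, Equiv.Perm.mul_apply, normalFormPerm_ofVertexProd]
  rfl

theorem exists_ofVertexProd_mul_eq {p q : 𝒢.PathGroup} (h : 𝒢.normalList p = 𝒢.normalList q) :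
    ∃ g, 𝒢.ofVertexProd g * q = p := by
  obtain ⟨g, hg⟩ := 𝒢.exists_eq_wordProd p
  obtain ⟨g', hg'⟩ := 𝒢.exists_eq_wordProd q
  refine ⟨g * g'⁻¹, ?_⟩
  rw [hg, hg', ← h, ← wordProd_mul, inv_mul_cancel_right]

theorem listDist_normalList_letter_mul (e : E) (b : Bool) (p : 𝒢.PathGroup) :
    listDist (𝒢.normalList p) (𝒢.normalList (𝒢.letter e b * p)) = 1 := by
  rw [normalList, normalList, map_mul, Equiv.Perm.mul_apply, normalFormPerm_letter_val]
  obtain ⟨⟨g, l⟩, hl⟩ := 𝒢.normalFormPerm p (NormalForm.one 𝒢)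
  rcases 𝒢.letterAct_cases e b g l with ⟨h, r, l, rfl⟩ | h
  · rw [letterAct_cancel 𝒢 h, listDist_comm]
    exact listDist_cons _ _
  · rw [letterAct_push 𝒢 h]
    exact listDist_cons _ _

theorem exists_eq_letter_mul {p q : 𝒢.PathGroup} {e : E} {b : Bool} {r : 𝒢.VertexProd}
    (h : 𝒢.normalList q = ((e, b), r) :: 𝒢.normalList p) :
    ∃ g g', q = 𝒢.ofVertexProd g * (𝒢.letter e b * (𝒢.ofVertexProd g' * p)) := by
  obtain ⟨g, hg⟩ := 𝒢.exists_eq_wordProd p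
  obtain ⟨g', hg'⟩ := 𝒢.exists_eq_wordProd q
  refine ⟨g', r * g⁻¹, ?_⟩
  conv_lhs => rw [hg', h, wordProd_cons]
  conv_rhs => rw [hg, ← wordProd_mul, inv_mul_cancel_right]

/-- Right translations respect adjacency of normal lists, because they commute with left
multiplication by letters. -/
theorem listDist_normalList_mul_of_eq_one {p q : 𝒢.PathGroup}
    (h : listDist (𝒢.normalList p) (𝒢.normalList q) = 1) (s : 𝒢.PathGroup) :
    listDist (𝒢.normalList (p * s)) (𝒢.normalList (q * s)) = 1 := by
  have key : ∀ {p q : 𝒢.PathGroup}, (∃ x, 𝒢.normalList q = x :: 𝒢.normalList p) →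
      listDist (𝒢.normalList (p * s)) (𝒢.normalList (q * s)) = 1 := by
    rintro p q ⟨⟨⟨e, b⟩, r⟩, h⟩
    obtain ⟨g, g', rfl⟩ := 𝒢.exists_eq_letter_mul h
    rw [mul_assoc, mul_assoc, mul_assoc, normalList_ofVertexProd_mul,
      ← 𝒢.normalList_ofVertexProd_mul g' (p * s)]
    exact 𝒢.listDist_normalList_letter_mul e b _
  rcases exists_eq_cons_of_listDist_eq_one h with h | h
  · exact key h
  · rw [listDist_comm]
    exact key h

/-- The exponent sum in the letters `t_e`. -/
def exponentSum : 𝒢.PathGroup →* Multiplicative ℤ :=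
  QuotientGroup.lift _ (Monoid.Coprod.lift 1 (FreeGroup.lift fun _ => Multiplicative.ofAdd 1)) (by
    refine Subgroup.normalClosure_le_normal ?_
    rintro _ ⟨e, c, rfl⟩
    simp [MonoidHom.mem_ker])

theorem exponentSum_ofVertexProd (g : 𝒢.VertexProd) : 𝒢.exponentSum (𝒢.ofVertexProd g) = 1 :=
  Monoid.Coprod.lift_apply_inl 1 (FreeGroup.lift fun _ : E => Multiplicative.ofAdd (1 : ℤ)) g

theorem exponentSum_ofEdge (e : E) : 𝒢.exponentSum (𝒢.ofEdge e) = Multiplicative.ofAdd 1 := by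
  refine (Monoid.Coprod.lift_apply_inr (1 : 𝒢.VertexProd →* Multiplicative ℤ)
    (FreeGroup.lift fun _ : E => Multiplicative.ofAdd (1 : ℤ)) (FreeGroup.of e)).trans ?_
  exact FreeGroup.lift_apply_of

theorem even_exponentSum_sub_length (p : 𝒢.PathGroup) :
    Even ((𝒢.exponentSum p).toAdd - (𝒢.normalList p).length) := by
  have key : ∀ g l, Even ((𝒢.exponentSum (𝒢.wordProd (g, l))).toAdd - (l.length : ℤ)) := by
    intro g l
    induction l generalizing g with
    | nil => simp [wordProd, exponentSum_ofVertexProd]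
    | cons x l ih =>
      obtain ⟨⟨e, b⟩, r⟩ := x
      have h1 := ih r
      rw [wordProd_cons, map_mul 𝒢.exponentSum, map_mul 𝒢.exponentSum, exponentSum_ofVertexProd,
        one_mul, toAdd_mul,
        List.length_cons, Nat.cast_succ]
      rw [Int.even_iff] at h1 ⊢
      have h2 : (𝒢.exponentSum (𝒢.letter e b)).toAdd = 1 ∨
          (𝒢.exponentSum (𝒢.letter e b)).toAdd = -1 := by
        cases b
        · right
          rw [letter, map_inv, exponentSum_ofEdge]
          rfl
        · left
          rw [letter, exponentSum_ofEdge]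
          rfl
      omega
  obtain ⟨g, hg⟩ := 𝒢.exists_eq_wordProd p
  have h := key g (𝒢.normalList p)
  rwa [← hg] at h

/-- The vertices of the tree of the path group. -/
abbrev TreeVertex : Type _ := 𝒢.PathGroup ⧸ 𝒢.ofVertexProd.range

/-- The normal list attached to a vertex of the tree. The inverse turns the left cosets that form the
tree into right cosets, on which normal lists are constant. -/
noncomputable def treeList (x : 𝒢.TreeVertex) : List ((E × Bool) × 𝒢.VertexProd) :=
  Quotient.liftOn' x (fun p => 𝒢.normalList p⁻¹) fun p q hpq => by
    obtain ⟨g, hg⟩ := QuotientGroup.leftRel_apply.mp hpq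
    have h : p⁻¹ = 𝒢.ofVertexProd g * q⁻¹ := by rw [hg, mul_inv_cancel_right]
    change 𝒢.normalList p⁻¹ = _
    rw [h, normalList_ofVertexProd_mul]

theorem treeList_mk (p : 𝒢.PathGroup) :
    𝒢.treeList (QuotientGroup.mk p) = 𝒢.normalList p⁻¹ :=
  rfl

theorem treeList_injective : Function.Injective 𝒢.treeList := by
  intro x y
  induction x using QuotientGroup.induction_on with | H p => ?_
  induction y using QuotientGroup.induction_on with | H q => ?_
  intro h
  obtain ⟨g, hg⟩ := 𝒢.exists_ofVertexProd_mul_eq h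
  refine QuotientGroup.eq.mpr ⟨g, ?_⟩
  rw [← hg, inv_mul_cancel_right]

/-- The distance in the tree of the path group. -/
noncomputable def treeDist (x y : 𝒢.TreeVertex) : ℕ :=
  listDist (𝒢.treeList x) (𝒢.treeList y)

theorem isTreeDist_treeDist : IsTreeDist 𝒢.treeDist := by
  refine isTreeDist_listDist 𝒢.treeList_injective fun x l hl => ?_
  induction x using QuotientGroup.induction_on with | H p => ?_
  refine ⟨QuotientGroup.mk (𝒢.wordProd (1, l))⁻¹, ?_⟩
  rw [treeList_mk, inv_inv, normalList_wordProd]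
  exact (𝒢.isReduced_normalList p⁻¹).of_suffix hl

theorem treeDist_smul (s : 𝒢.PathGroup) (x y : 𝒢.TreeVertex) :
    𝒢.treeDist (s • x) (s • y) = 𝒢.treeDist x y := by
  have hd := 𝒢.isTreeDist_treeDist
  have h1 : ∀ (s : 𝒢.PathGroup) (x y : 𝒢.TreeVertex), 𝒢.treeDist x y = 1 →
      𝒢.treeDist (s • x) (s • y) = 1 := by
    intro s x y h
    induction x using QuotientGroup.induction_on with | H p => ?_
    induction y using QuotientGroup.induction_on with | H q => ?_
    have h2 := 𝒢.listDist_normalList_mul_of_eq_one h s⁻¹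
    rw [← mul_inv_rev, ← mul_inv_rev] at h2
    exact h2
  have h2 : ∀ (n : ℕ) (s : 𝒢.PathGroup) (x y : 𝒢.TreeVertex), 𝒢.treeDist x y = n →
      𝒢.treeDist (s • x) (s • y) ≤ n := by
    intro n
    induction n with
    | zero =>
      intro s x y h
      rw [hd.eq_of_zero h, hd.self]
    | succ n ih =>
      intro s x y h
      obtain ⟨z, hz1, hz2⟩ := hd.exists_point (x := x) (y := y) (k := n) (by omega)
      have h3 := hd.triangle (s • x) (s • z) (s • y)
      have h4 := ih s x z hz1
      have h5 := h1 s z y (by omega)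
      omega
  refine le_antisymm (h2 _ s x y rfl) ?_
  have h3 := h2 _ s⁻¹ (s • x) (s • y) rfl
  rwa [inv_smul_smul, inv_smul_smul] at h3

/-- The path group acts without inversions: an element exchanging two vertices has exponent sum `0`,
hence moves each vertex by an even distance. -/
theorem even_treeDist_smul {s : 𝒢.PathGroup} {x : 𝒢.TreeVertex} (h : s • s • x = x) :
    Even (𝒢.treeDist x (s • x)) := by
  induction x using QuotientGroup.induction_on with | H p => ?_
  have h0 : (𝒢.exponentSum s).toAdd = 0 := by
    obtain ⟨g, hg⟩ := QuotientGroup.eq.mp (show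
      (QuotientGroup.mk p : 𝒢.TreeVertex) = QuotientGroup.mk (s * (s * p)) from h.symm)
    have h1 := congrArg (fun p => (𝒢.exponentSum p).toAdd) hg
    simp only [exponentSum_ofVertexProd, map_mul, map_inv, toAdd_mul, toAdd_inv, toAdd_one] at h1
    omega
  have h1 := 𝒢.even_exponentSum_sub_length p⁻¹
  have h2 := 𝒢.even_exponentSum_sub_length (s * p)⁻¹
  have h3 := listDist_add (𝒢.normalList p⁻¹) (𝒢.normalList (s * p)⁻¹)
  change Even (listDist (𝒢.normalList p⁻¹) (𝒢.normalList (s * p)⁻¹))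
  rw [map_inv, toAdd_inv] at h1 h2
  rw [map_mul 𝒢.exponentSum, toAdd_mul] at h2
  rw [Int.even_iff] at h1 h2
  rw [Nat.even_iff]
  omega

/-- Vertex stabilizers are conjugate into the free product of the vertex groups, which is free. -/
theorem isFreeGroup_stabilizer [∀ v, IsFreeGroup (𝒢.vertexGroup v)] (x : 𝒢.TreeVertex) :
    IsFreeGroup (MulAction.stabilizer 𝒢.PathGroup x) := by
  induction x using QuotientGroup.induction_on with | H p => ?_
  have h1 : IsFreeGroup 𝒢.ofVertexProd.range :=
    IsFreeGroup.ofMulEquiv (MonoidHom.ofInjective 𝒢.ofVertexProd_injective)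
  let f : MulAction.stabilizer 𝒢.PathGroup (QuotientGroup.mk p : 𝒢.TreeVertex) →*
      𝒢.ofVertexProd.range :=
    ((MulAut.conj p⁻¹).toMonoidHom.comp (Subgroup.subtype _)).codRestrict _ fun s => by
      have h2 := QuotientGroup.eq.mp (show
        (QuotientGroup.mk p : 𝒢.TreeVertex) = QuotientGroup.mk (s.1 * p) from s.2.symm)
      simpa [mul_assoc] using h2
  have hf : Function.Injective f := fun s t hst =>
    Subtype.ext ((MulAut.conj p⁻¹).injective (congrArg Subtype.val hst))
  exact IsFreeGroup.ofMulEquiv (MonoidHom.ofInjective hf).symm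

end GraphOfGroups

/-! ### Groups that split as graphs of free groups -/

theorem GraphOfGroups.exists_embedsIn_of_isVeryUnbalanced {V E : Type*} (𝒢 : GraphOfGroups V E)
    [∀ v, IsFreeGroup (𝒢.vertexGroup v)] {G : Type*} [Group G] {f : G →* 𝒢.PathGroup}
    (hf : Function.Injective f) {g : G} (hg : IsVeryUnbalanced g) :
    ∃ p q : ℤ, p ≠ 0 ∧ q ≠ 0 ∧ |p| ≠ 1 ∧ |q| ≠ 1 ∧ |p| ≠ |q| ∧
      EmbedsIn (BaumslagSolitar p q) G := by
  let : MulAction G 𝒢.TreeVertex := MulAction.compHom _ f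
  refine 𝒢.isTreeDist_treeDist.exists_embedsIn_of_isVeryUnbalanced
    (fun s x y => 𝒢.treeDist_smul (f s) x y) (fun s x h => 𝒢.even_treeDist_smul h)
    (fun x => ?_) hg
  have := 𝒢.isFreeGroup_stabilizer x
  let φ : MulAction.stabilizer G x →* MulAction.stabilizer 𝒢.PathGroup x :=
    (f.comp (Subgroup.subtype _)).codRestrict _ fun s => s.2
  have hφ : Function.Injective φ := fun s t hst =>
    Subtype.ext (hf (congrArg Subtype.val hst))
  exact IsFreeGroup.ofMulEquiv (MonoidHom.ofInjective hφ).symm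

theorem proposition3p6 {G : Type*} [Group G] {V E : Type*} (𝒢 : GraphOfGroups V E)
    (hfree : ∀ v, IsFreeGroup (𝒢.vertexGroup v)) (v₀ : V)
    (splitting : G ≃* 𝒢.fundamentalGroup v₀) :
    (((∃ g : G, IsUnbalanced g) ↔
        ∃ p q : ℤ, p ≠ 0 ∧ q ≠ 0 ∧ |p| ≠ |q| ∧ EmbedsIn (BaumslagSolitar p q) G) ∧
      ((∃ g : G, IsUnbalanced g) → ¬ IsLERF G)) ∧
    (((∃ g : G, IsVeryUnbalanced g) ↔
        ∃ p q : ℤ, p ≠ 0 ∧ q ≠ 0 ∧ |p| ≠ 1 ∧ |q| ≠ 1 ∧ |p| ≠ |q| ∧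
          EmbedsIn (BaumslagSolitar p q) G) ∧
      ((∃ g : G, IsVeryUnbalanced g) → ¬ Group.ResiduallyFinite G)) := by
  let f : G →* 𝒢.PathGroup := (𝒢.fundamentalGroup v₀).subtype.comp splitting.toMonoidHom
  have hf : Function.Injective f := Subtype.val_injective.comp splitting.injective
  have key : ∀ g : G, IsVeryUnbalanced g → ∃ p q : ℤ, p ≠ 0 ∧ q ≠ 0 ∧ |p| ≠ 1 ∧ |q| ≠ 1 ∧
      |p| ≠ |q| ∧ EmbedsIn (BaumslagSolitar p q) G :=
    fun g hg => 𝒢.exists_embedsIn_of_isVeryUnbalanced hf hg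
  refine ⟨⟨⟨?_, ?_⟩, ?_⟩, ⟨?_, ?_⟩, ?_⟩
  · rintro ⟨g, h, m, n, hg⟩
    rcases hg.isVeryUnbalancedFor_or_embedsIn with hg | ⟨l, hl, hl1, hemb⟩
    · obtain ⟨p, q, hp, hq, -, -, hpq, hemb⟩ := key g ⟨h, m, n, hg⟩
      exact ⟨p, q, hp, hq, hpq, hemb⟩
    · exact ⟨1, l, one_ne_zero, hl, by rw [abs_one]; exact hl1.symm, hemb⟩
  · rintro ⟨p, q, hp, hq, hpq, hemb⟩
    exact BaumslagSolitar.isUnbalanced_of_embedsIn hp hq hpq hemb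
  · rintro ⟨g, hg⟩
    exact hg.not_isLERF
  · rintro ⟨g, hg⟩
    exact key g hg
  · rintro ⟨p, q, hp, hq, hp1, hq1, hpq, hemb⟩
    exact BaumslagSolitar.isVeryUnbalanced_of_embedsIn hp hq hp1 hq1 hpq hemb
  · rintro ⟨g, hg⟩
    obtain ⟨p, q, hp, hq, hp1, hq1, hpq, hemb⟩ := key g hg
    exact BaumslagSolitar.not_residuallyFinite_of_embedsIn hp hq hp1 hq1 hpq hemb
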